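/- All objects form sequences indexed by $n$, with dimension $d=d_n\to\infty$; $O,o,\Theta,\ll$ refer to $n\to\infty$ and are uniform over coordinates $i$ and hidden nodes $h$. **Data.** $Z=MX+\xi\in\mathbb R^d$ with $M$ a real orthogonal $d\times d$ matrix. The coordinates of $X$ are i.i.d. symmetric with $|X_i|\in\{0\}\cup[1/\sqrt k,1]$ almost surely, $k\ll d$, $P(X_i\ne0)=\Theta(k/d)$, $\mathbb E X_i^2=\Theta(1/d)$, $\mathbb E|X_i|=\Theta(\sqrt k/d)$, $\mathbb E|X_i|^3=\Theta(1/(d\sqrt k))$. The noise $\xi\sim N(0,\zeta^2I_d/d)$, with fixed $\zeta>0$, is independent of $X$. Let $\mathcal X=\{i: X_i\neq0\}$. **Network.** Let $\mathbb I(v,e)=1\{|v|\ge e\}$, applied entrywise to vectors, and $f(z)=f_{W,b}(z)=\sum_{h=1}^H a_h\,(z^\top W_h)\,\mathbb I(z^\top W_h,b_h)$ with $a_h=1$, and let $U=M^\top W$ with columns $U_h$. Node $h$ is activated when its gate equals $1$. Assume $(W,b)\in\mathcal M$, that is, for some sequences $m^*$ and $\gamma$: (1) $b_h\ll\|U_h\|_2/\sqrt{k\|U_h\|_0}$;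 (2) $b_h\gg\|U_h\|_2/(\sqrt{k\|U_h\|_0}\,\log d)\gg\|U_h\|_2/\sqrt d$; (3) $\|U_h\|_0\le m^*$, $m^*=o(d/k)$, $U_h\neq0$, and $H\gg d$; (4) for each $i$ the nonzero $U_{i,h}$ have the same sign, and the nonzero $|U_{i,h}|$ are $\Theta(\gamma)$. Assume also $H=o(d^2/(k^2m^2))$ with $m=\max_h\|U_h\|_0$. Let $\theta=Ua$ with $\|\theta\|_\infty=\Theta(1)$, let $\theta_{\mathcal X}$ be the vector of coordinates of $\theta$ in $\mathcal X$, and let $0\le\epsilon=O(1/(\log d\,\sqrt{m^*k}))$. **Attack.** For a loss $l(f,y)$ the FGM attack is $\delta=\epsilon\,\nabla_z l(f(z),y)/\|\nabla_z l(f(z),y)\|_2$ (with $\delta=0$ if the gradient vanishes), and $\Delta_{W,b}(z,y)=l(f(z+\delta),y)-l(f(z),y)$. Put $$N(z)=\|a^\top\mathrm{diag}(\mathbb I(W^\top z,b))W^\top\|_2,\qquad N_0(x)=\|a^\top\mathrm{diag}(\mathbb I(U^\top x,b))U^\top\|_2 .$$ **Claims.** (i) With probability tending to 1 over $(X,\xi)$,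 simultaneously for all $y$ and all $L\ge0$ such that $l(\cdot,y)$ is differentiable with $L$-Lipschitz derivative on the interval between $f(Z)$ and $f(Z+\delta)$, $$\Big|\Delta_{W,b}(Z,y)-\epsilon\,\Big|\frac{\partial l}{\partial f}(f(Z),y)\Big|\,N(Z)\Big|\le\frac L2\,(\epsilon N(Z))^2,$$ and $\epsilon N(Z)\to0$ in probability. So the remainder is of second order in $\epsilon N(Z)$ and is due to the curvature of the loss only. (ii) With probability tending to 1, $\|\theta_{\mathcal X}\|_2\le N_0(X)\le\|\theta\|_2$ and $\|\theta_{\mathcal X}\|_2\le N(Z)\le\|\theta\|_2$. (iii) With probability tending to 1, $N_0(X)=\|\theta_{\mathcal X}\|_2$ if and only if every activated hidden node $h$ (gates evaluated at $U^\top X$) has $\|U_h\|_0\le1$. Moreover, for all sufficiently large $n$, if $N_0(X)=\|\theta_{\mathcal X}\|_2$ almost surely, then $\|U_h\|_0\le1$ for every $h$. The same two statements hold for $N(Z)$ with gates evaluated at $W^\top Z$. (iv) For every realization in which all hidden nodes are activated by $U^\top X$ (respectively $W^\top Z$), $N_0(X)=\|\theta\|_2$ (respectively $N(Z)=\|\theta\|_2$).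 -/

import Mathlib

open Filter Topology MeasureTheory ProbabilityTheory Asymptotics
open scoped NNReal ENNReal Matrix

noncomputable section

/-! Asymptotic comparisons, along an index tending to infinity, that are uniform over an extra
(index-dependent) label such as a coordinate or a hidden node. -/

/-- `f = Θ(g)` with constants uniform over the labels. -/
def UnifTheta {ι : ℕ → Type*} (f g : (n : ℕ) → ι n → ℝ) : Prop :=
  ∃ c > 0, ∃ C > 0, ∀ᶠ n in atTop, ∀ i, c * g n i ≤ f n i ∧ f n i ≤ C * g n i

/-- `f ≪ g` for a nonnegative `f`, uniformly over the labels (in particular `g ≥ 0` eventually). -/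
def UnifMuchLess {ι : ℕ → Type*} (f g : (n : ℕ) → ι n → ℝ) : Prop :=
  ∀ c > 0, ∀ᶠ n in atTop, ∀ i, f n i ≤ c * g n i

/-- `E n` holds with probability tending to 1: its complement has (outer) probability tending
to 0. -/
def WithHighProb {Ω : ℕ → Type*} [∀ n, MeasurableSpace (Ω n)] (P : (n : ℕ) → Measure (Ω n))
    (E : (n : ℕ) → Ω n → Prop) : Prop :=
  Tendsto (fun n => P n {ω | ¬ E n ω}) atTop (𝓝 0)

/-! The two-layer gated network. -/

/-- The gate `𝕀(v, e) = 1{|v| ≥ e}`. -/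
def gate (v e : ℝ) : ℝ := if e ≤ |v| then 1 else 0

/-- The activation `σ(v, e) = v · 1{|v| ≥ e}`. -/
def gatedActivation (v e : ℝ) : ℝ := v * gate v e

/-- `f_{W,b}(z) = ∑_h a_h σ(zᵀ W_h, b_h)`. -/
def network {d H : ℕ} (a : Fin H → ℝ) (W : Matrix (Fin d) (Fin H) ℝ) (b : Fin H → ℝ)
    (z : EuclideanSpace ℝ (Fin d)) : ℝ :=
  ∑ h, a h * gatedActivation ((Wᵀ *ᵥ z.ofLp) h) (b h)

/-- The vector `aᵀ diag(𝕀(Vᵀ v, b)) Vᵀ`, with the Euclidean norm. -/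
def gatedWeights {d H : ℕ} (a : Fin H → ℝ) (V : Matrix (Fin d) (Fin H) ℝ) (b : Fin H → ℝ)
    (v : EuclideanSpace ℝ (Fin d)) : EuclideanSpace ℝ (Fin d) :=
  WithLp.toLp 2 (a ᵥ* (Matrix.diagonal (fun h => gate ((Vᵀ *ᵥ v.ofLp) h) (b h)) * Vᵀ))

/-- Euclidean norm of the `h`-th column. -/
def colNorm {d H : ℕ} (V : Matrix (Fin d) (Fin H) ℝ) (h : Fin H) : ℝ :=
  ‖(WithLp.toLp 2 (fun i => V i h) : EuclideanSpace ℝ (Fin d))‖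

/-- Number of nonzero entries of the `h`-th column. -/
def colNorm0 {d H : ℕ} (V : Matrix (Fin d) (Fin H) ℝ) (h : Fin H) : ℕ :=
  Set.ncard {i | V i h ≠ 0}

/-- `θ_𝒳`: the coordinates of `θ` at the nonzero coordinates of `x` (the others set to zero). -/
def restrictActive {d : ℕ} (θ x : EuclideanSpace ℝ (Fin d)) : EuclideanSpace ℝ (Fin d) :=
  WithLp.toLp 2 (Set.indicator {i | x i ≠ 0} θ.ofLp)

/-! The fast gradient attack for a loss `l(f, y)`. -/

/-- `δ = ε ∇_z l / ‖∇_z l‖` (zero when the gradient vanishes). -/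
def fgmAttack {d H : ℕ} (l : ℝ → ℝ → ℝ) (ε : ℝ) (a : Fin H → ℝ) (W : Matrix (Fin d) (Fin H) ℝ)
    (b : Fin H → ℝ) (z : EuclideanSpace ℝ (Fin d)) (y : ℝ) : EuclideanSpace ℝ (Fin d) :=
  (ε / ‖gradient (fun u => l (network a W b u) y) z‖) •
    gradient (fun u => l (network a W b u) y) z

/-- The increase `Δ_{W,b}(z, y)` of the loss caused by the attack. -/
def lossIncrease {d H : ℕ} (l : ℝ → ℝ → ℝ) (ε : ℝ) (a : Fin H → ℝ)
    (W : Matrix (Fin d) (Fin H) ℝ) (b : Fin H → ℝ) (z : EuclideanSpace ℝ (Fin d)) (y : ℝ) : ℝ :=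
  l (network a W b (z + fgmAttack l ε a W b z y)) y - l (network a W b z) y

/-! The sparse coding model. -/

/-- The observed features `Z = M X + ξ`. -/
def observed {d : ℕ} (M : Matrix (Fin d) (Fin d) ℝ) (x ξ : EuclideanSpace ℝ (Fin d)) :
    EuclideanSpace ℝ (Fin d) :=
  WithLp.toLp 2 (M *ᵥ x.ofLp) + ξ

/-- Sparse coding model, as a sequence indexed by `n` with dimension `d n → ∞`: unitary
(real orthogonal) dictionary `M`, i.i.d. symmetric sparse true features `X` and independent
Gaussian noise `ξ`. -/
structure SparseCodingModel {Ω : ℕ → Type*} [∀ n, MeasurableSpace (Ω n)]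
    (P : (n : ℕ) → Measure (Ω n)) (d : ℕ → ℕ) (k : ℕ → ℝ) (ζ : ℝ)
    (M : (n : ℕ) → Matrix (Fin (d n)) (Fin (d n)) ℝ)
    (X ξ : (n : ℕ) → Ω n → EuclideanSpace ℝ (Fin (d n))) : Prop where
  dim_tendsto : Tendsto d atTop atTop
  sparsity : k =o[atTop] (fun n => (d n : ℝ))
  orthogonal : ∀ n, M n ∈ Matrix.orthogonalGroup (Fin (d n)) ℝ
  measurable_X : ∀ n, Measurable (X n)
  measurable_noise : ∀ n, Measurable (ξ n)
  indep_coord : ∀ n, iIndepFun (fun i ω => X n ω i) (P n)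
  identDistrib_coord : ∀ n i j,
    IdentDistrib (fun ω => X n ω i) (fun ω => X n ω j) (P n) (P n)
  symmetric_coord : ∀ n i,
    IdentDistrib (fun ω => X n ω i) (fun ω => - X n ω i) (P n) (P n)
  support_coord : ∀ n i, ∀ᵐ ω ∂(P n),
    X n ω i = 0 ∨ |X n ω i| ∈ Set.Icc (1 / √(k n)) 1
  prob_active : UnifTheta (ι := fun n => Fin (d n))
    (fun n i => (P n).real {ω | X n ω i ≠ 0}) (fun n _ => k n / d n)
  second_moment : UnifTheta (ι := fun n => Fin (d n))
    (fun n i => ∫ ω, X n ω i ^ 2 ∂(P n)) (fun n _ => 1 / d n)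
  first_moment : UnifTheta (ι := fun n => Fin (d n))
    (fun n i => ∫ ω, |X n ω i| ∂(P n)) (fun n _ => √(k n) / d n)
  third_moment : UnifTheta (ι := fun n => Fin (d n))
    (fun n i => ∫ ω, |X n ω i| ^ 3 ∂(P n)) (fun n _ => 1 / (d n * √(k n)))
  noise_scale_pos : 0 < ζ
  noise_indep_coord : ∀ n, iIndepFun (fun i ω => ξ n ω i) (P n)
  noise_law : ∀ n i,
    (P n).map (fun ω => ξ n ω i) = gaussianReal 0 (Real.toNNReal (ζ ^ 2 / d n))
  noise_indep : ∀ n, IndepFun (X n) (ξ n) (P n)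

/-- The class `ℳ` of (sequences of) two-layer networks `(W, b)`, in terms of `U = Mᵀ W`. -/
structure NetworkClass (d H : ℕ → ℕ) (k mstar γ : ℕ → ℝ)
    (M : (n : ℕ) → Matrix (Fin (d n)) (Fin (d n)) ℝ)
    (W : (n : ℕ) → Matrix (Fin (d n)) (Fin (H n)) ℝ)
    (b : (n : ℕ) → Fin (H n) → ℝ) : Prop where
  intercept_upper : UnifMuchLess (ι := fun n => Fin (H n)) b
    (fun n h => colNorm ((M n)ᵀ * W n) h / √(k n * colNorm0 ((M n)ᵀ * W n) h))
  intercept_lower : UnifMuchLess (ι := fun n => Fin (H n))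
    (fun n h => colNorm ((M n)ᵀ * W n) h / √(k n * colNorm0 ((M n)ᵀ * W n) h) / Real.log (d n)) b
  noise_level : UnifMuchLess (ι := fun n => Fin (H n))
    (fun n h => colNorm ((M n)ᵀ * W n) h / √(d n))
    (fun n h => colNorm ((M n)ᵀ * W n) h / √(k n * colNorm0 ((M n)ᵀ * W n) h) / Real.log (d n))
  feature_count : ∀ n h, (colNorm0 ((M n)ᵀ * W n) h : ℝ) ≤ mstar n
  feature_count_small : mstar =o[atTop] (fun n => (d n : ℝ) / k n)
  node_ne_zero : ∀ n h, ∃ i, ((M n)ᵀ * W n) i h ≠ 0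
  width : (fun n => (d n : ℝ)) =o[atTop] (fun n => (H n : ℝ))
  same_sign : ∀ n i h h', 0 ≤ ((M n)ᵀ * W n) i h * ((M n)ᵀ * W n) i h'
  magnitude : ∃ c > 0, ∃ C > 0, ∀ᶠ n in atTop, ∀ i h, ((M n)ᵀ * W n) i h ≠ 0 →
    c * γ n ≤ |((M n)ᵀ * W n) i h| ∧ |((M n)ᵀ * W n) i h| ≤ C * γ n

end

/-!
By orthogonality of the dictionary, `Wᵀ Z = Uᵀ X + Wᵀ ξ`, and `Wᵀ ξ` has Gaussian coordinates of
standard deviation `ζ ‖U_h‖ / √d`. Everything follows from one event of high probability, on which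
a node is activated exactly when its support contains an active feature (`IsTypical`).

* Two active features in the support of a single node have probability at most `(C k ‖U_h‖₀ / d)²`,
  and `H = o(d² / (k m)²)` makes the union over the nodes negligible (`withHighProb_overlap`).
* A single active feature contributes at least `|U_{ih}| / √k`, which is at least twice the
  threshold (`NetworkClass.eventually_isSeparated`).
* Since `d ≤ H ≤ (d / (k m))²` eventually, the thresholds exceed the standard deviation of the noise
  by a power of `d`, up to logarithms, and no node sees a noise larger than half its threshold
  (`withHighProb_noise`).

On this event all node inputs keep a relative distance from the thresholds. So the gates do not
depend on the noise, nor do they switch within the reach of the attack: the network is linear there,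
and the expansion of the loss is a one-dimensional Taylor estimate (`abs_lossIncrease_sub_le`).
As the weights of a feature have a common sign, the modulus of the `i`-th gated weight is the sum of
`|U_{ih}|` over the activated nodes. It is at most `|θ_i|`, with equality at the active features;
elsewhere it vanishes unless an activated node leaks weight from an active to an inactive feature,
that is, unless it has at least two features (`IsTypical.norm_restrictActive_eq_iff`).

If the lower bound is attained almost surely, each node is pure because, with positive probability,
the realization is typical and a prescribed feature in the support of this node is active
(`eventually_frequently_isTypical`). Finally, `N² ≤ C m* |𝒳|` on the typical event, as an activated
node has `ℓ¹`-mass at most `C m*` times its weight at an active feature, and `|𝒳| ≤ k log d` with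
high probability by Markov's inequality; this gives `ε N → 0`.
-/

/-! ### Same-sign sums and norm comparisons -/

theorem abs_sum_mul_of_same_sign {ι : Type*} [Fintype ι] {g u : ι → ℝ}
    (hu : ∀ h h', 0 ≤ u h * u h') (hg : ∀ h, 0 ≤ g h) :
    |∑ h, g h * u h| = ∑ h, g h * |u h| := by
  rcases em (∃ h, 0 < u h) with ⟨h0, hpos⟩ | hneg
  · have hnn : ∀ h, 0 ≤ u h := fun h => nonneg_of_mul_nonneg_right (hu h0 h) hpos
    rw [abs_of_nonneg (Finset.sum_nonneg fun h _ => mul_nonneg (hg h) (hnn h))]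
    exact Finset.sum_congr rfl fun h _ => by rw [abs_of_nonneg (hnn h)]
  · push Not at hneg
    rw [abs_of_nonpos (Finset.sum_nonpos fun h _ => mul_nonpos_of_nonneg_of_nonpos (hg h) (hneg h)),
      ← Finset.sum_neg_distrib]
    exact Finset.sum_congr rfl fun h _ => by rw [abs_of_nonpos (hneg h)]; ring

theorem EuclideanSpace.norm_le_norm_of_abs_le {ι : Type*} [Fintype ι] {v w : EuclideanSpace ℝ ι}
    (h : ∀ i, |v i| ≤ |w i|) : ‖v‖ ≤ ‖w‖ := by
  rw [← sq_le_sq₀ (norm_nonneg _) (norm_nonneg _), EuclideanSpace.real_norm_sq_eq,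
    EuclideanSpace.real_norm_sq_eq]
  exact Finset.sum_le_sum fun i _ => sq_le_sq.mpr (h i)

theorem EuclideanSpace.norm_eq_norm_iff_of_abs_le {ι : Type*} [Fintype ι]
    {v w : EuclideanSpace ℝ ι} (h : ∀ i, |v i| ≤ |w i|) :
    ‖v‖ = ‖w‖ ↔ ∀ i, |v i| = |w i| := by
  rw [← sq_eq_sq₀ (norm_nonneg _) (norm_nonneg _), EuclideanSpace.real_norm_sq_eq,
    EuclideanSpace.real_norm_sq_eq, Finset.sum_eq_sum_iff_of_le fun i _ => sq_le_sq.mpr (h i)]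
  simp [sq_eq_sq_iff_abs_eq_abs]

/-! ### The gates and the rotation by the dictionary -/

theorem gate_nonneg (v e : ℝ) : 0 ≤ gate v e := by unfold gate; split_ifs <;> norm_num

theorem gate_le_one (v e : ℝ) : gate v e ≤ 1 := by unfold gate; split_ifs <;> norm_num

theorem gate_of_le {v e : ℝ} (h : e ≤ |v|) : gate v e = 1 := if_pos h

theorem gate_of_lt {v e : ℝ} (h : |v| < e) : gate v e = 0 := if_neg h.not_ge

theorem gate_congr {v w e : ℝ} (h : e ≤ |v| ↔ e ≤ |w|) : gate v e = gate w e :=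
  if_congr h rfl rfl

section Rotation

variable {d H : ℕ}

theorem gatedWeights_apply (a : Fin H → ℝ) (V : Matrix (Fin d) (Fin H) ℝ) (b : Fin H → ℝ)
    (v : EuclideanSpace ℝ (Fin d)) (i : Fin d) :
    gatedWeights a V b v i = ∑ h, a h * gate ((Vᵀ *ᵥ v.ofLp) h) (b h) * V i h := by
  simp [gatedWeights, Matrix.vecMul, dotProduct, Matrix.diagonal_mul, mul_assoc]

theorem gatedWeights_eq_mulVec (a : Fin H → ℝ) (V : Matrix (Fin d) (Fin H) ℝ) (b : Fin H → ℝ)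
    (v : EuclideanSpace ℝ (Fin d)) :
    (gatedWeights a V b v).ofLp = V *ᵥ fun h => a h * gate ((Vᵀ *ᵥ v.ofLp) h) (b h) := by
  ext i
  rw [gatedWeights_apply]
  exact Finset.sum_congr rfl fun h _ => mul_comm _ _

variable {M : Matrix (Fin d) (Fin d) ℝ}

theorem norm_toLp_transpose_mulVec (hM : M ∈ Matrix.orthogonalGroup (Fin d) ℝ) (v : Fin d → ℝ) :
    ‖(WithLp.toLp 2 (Mᵀ *ᵥ v) : EuclideanSpace ℝ (Fin d))‖
      = ‖(WithLp.toLp 2 v : EuclideanSpace ℝ (Fin d))‖ := by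
  have key : (Mᵀ *ᵥ v) ⬝ᵥ (Mᵀ *ᵥ v) = v ⬝ᵥ v := by
    have hM' : M * Mᵀ = 1 := (Matrix.mem_orthogonalGroup_iff (Fin d) ℝ).mp hM
    rw [Matrix.dotProduct_mulVec, Matrix.vecMul_transpose, Matrix.mulVec_mulVec, hM',
      Matrix.one_mulVec]
  rw [← sq_eq_sq₀ (norm_nonneg _) (norm_nonneg _), EuclideanSpace.real_norm_sq_eq,
    EuclideanSpace.real_norm_sq_eq]
  simpa [dotProduct, sq] using key

theorem colNorm_transpose_mul (hM : M ∈ Matrix.orthogonalGroup (Fin d) ℝ)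
    (W : Matrix (Fin d) (Fin H) ℝ) (h : Fin H) : colNorm (Mᵀ * W) h = colNorm W h := by
  rw [colNorm, colNorm, ← norm_toLp_transpose_mulVec hM fun i => W i h]
  rfl

theorem transpose_mulVec_observed (M : Matrix (Fin d) (Fin d) ℝ) (W : Matrix (Fin d) (Fin H) ℝ) (x ξ : EuclideanSpace ℝ (Fin d)) (h : Fin H) :
    (Wᵀ *ᵥ (observed M x ξ).ofLp) h = ((Mᵀ * W)ᵀ *ᵥ x.ofLp) h + (Wᵀ *ᵥ ξ.ofLp) h := by
  simp [observed, Matrix.mulVec_add, Matrix.transpose_mul]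

/-- The orthogonal dictionary does not change the norm of the gated weights, as long as the gates
agree. -/
theorem norm_gatedWeights_eq_of_gate_eq (hM : M ∈ Matrix.orthogonalGroup (Fin d) ℝ)
    {a : Fin H → ℝ} {W : Matrix (Fin d) (Fin H) ℝ} {b : Fin H → ℝ}
    {z x : EuclideanSpace ℝ (Fin d)}
    (hg : ∀ h, gate ((Wᵀ *ᵥ z.ofLp) h) (b h) = gate (((Mᵀ * W)ᵀ *ᵥ x.ofLp) h) (b h)) :
    ‖gatedWeights a W b z‖ = ‖gatedWeights a (Mᵀ * W) b x‖ := by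
  rw [← WithLp.toLp_ofLp (p := 2) (gatedWeights a W b z),
    ← WithLp.toLp_ofLp (p := 2) (gatedWeights a (Mᵀ * W) b x), gatedWeights_eq_mulVec,
    gatedWeights_eq_mulVec, ← norm_toLp_transpose_mulVec hM, Matrix.mulVec_mulVec]
  simp only [hg]

/-- When every node is activated the gated weights are, up to the rotation, all of `θ = U a`. -/
theorem norm_gatedWeights_of_forall_le (hM : M ∈ Matrix.orthogonalGroup (Fin d) ℝ)
    {a : Fin H → ℝ} {W : Matrix (Fin d) (Fin H) ℝ} {b : Fin H → ℝ}
    {z : EuclideanSpace ℝ (Fin d)} (hact : ∀ h, b h ≤ |(Wᵀ *ᵥ z.ofLp) h|) :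
    ‖gatedWeights a W b z‖
      = ‖(WithLp.toLp 2 ((Mᵀ * W) *ᵥ a) : EuclideanSpace ℝ (Fin d))‖ := by
  rw [← WithLp.toLp_ofLp (p := 2) (gatedWeights a W b z), gatedWeights_eq_mulVec,
    ← norm_toLp_transpose_mulVec hM, Matrix.mulVec_mulVec]
  simp only [gate_of_le (hact _), mul_one]

theorem abs_transpose_mulVec_le (W : Matrix (Fin d) (Fin H) ℝ) (v : EuclideanSpace ℝ (Fin d))
    (h : Fin H) : |(Wᵀ *ᵥ v.ofLp) h| ≤ colNorm W h * ‖v‖ := by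
  have := abs_real_inner_le_norm v (WithLp.toLp 2 (fun i => W i h) : EuclideanSpace ℝ (Fin d))
  rw [mul_comm]
  simpa [PiLp.inner_apply, Matrix.mulVec, dotProduct, colNorm] using this

end Rotation

/-! ### First-order expansion of the loss under the attack -/

/-- First-order Taylor estimate on the segment between `s` and `t`, for a function whose
derivative is `L`-Lipschitz on that segment only. -/
theorem abs_sub_sub_deriv_mul_le_of_lipschitzOnWith {φ : ℝ → ℝ} {s t : ℝ} {L : ℝ≥0}
    (hφ : ∀ u ∈ Set.uIcc s t, DifferentiableAt ℝ φ u)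
    (hL : LipschitzOnWith L (deriv φ) (Set.uIcc s t)) :
    |φ t - φ s - deriv φ s * (t - s)| ≤ L / 2 * (t - s) ^ 2 := by
  have hmem : ∀ x ∈ Set.Icc (0 : ℝ) 1, s + x * (t - s) ∈ Set.uIcc s t := by
    intro x hx
    have := (convex_uIcc s t).add_smul_sub_mem Set.left_mem_uIcc Set.right_mem_uIcc hx
    simpa using this
  set F : ℝ → ℝ := fun x => φ (s + x * (t - s)) - φ s - x * (deriv φ s * (t - s)) with hF
  have hF' : ∀ x ∈ Set.Icc (0 : ℝ) 1,
      HasDerivAt F ((deriv φ (s + x * (t - s)) - deriv φ s) * (t - s)) x := by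
    intro x hx
    have h1 : HasDerivAt (fun x : ℝ => s + x * (t - s)) (t - s) x := by
      simpa using ((hasDerivAt_id x).mul_const (t - s)).const_add s
    have h2 := ((hφ _ (hmem x hx)).hasDerivAt.comp x h1).sub_const (φ s)
    have h3 := h2.sub ((hasDerivAt_id x).mul_const (deriv φ s * (t - s)))
    refine h3.congr_deriv ?_
    ring
  have hB : ∀ x : ℝ, HasDerivAt (fun x : ℝ => (L : ℝ) / 2 * (t - s) ^ 2 * x ^ 2)
      ((L : ℝ) * (t - s) ^ 2 * x) x := by
    intro x
    refine ((hasDerivAt_pow 2 x).const_mul ((L : ℝ) / 2 * (t - s) ^ 2)).congr_deriv ?_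
    push_cast
    ring
  have := image_norm_le_of_norm_deriv_right_le_deriv_boundary (a := 0) (b := 1)
    (f := F) (fun x hx => (hF' x hx).continuousAt.continuousWithinAt)
    (fun x hx => (hF' x ⟨hx.1, hx.2.le⟩).hasDerivWithinAt) (by simp [hF]) hB
    (by
      intro x hx
      have hlip := hL.norm_sub_le (hmem x ⟨hx.1, hx.2.le⟩) Set.left_mem_uIcc
      rw [add_sub_cancel_left, norm_mul, Real.norm_of_nonneg hx.1] at hlip
      calc ‖(deriv φ (s + x * (t - s)) - deriv φ s) * (t - s)‖
          ≤ L * (x * ‖t - s‖) * ‖t - s‖ := by rw [norm_mul]; gcongr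
        _ = L * (t - s) ^ 2 * x := by rw [Real.norm_eq_abs, ← sq_abs (t - s)]; ring)
    (Set.right_mem_Icc.mpr zero_le_one)
  simpa [hF] using this

section Attack

variable {d H : ℕ} {a : Fin H → ℝ} {W : Matrix (Fin d) (Fin H) ℝ} {b : Fin H → ℝ}

theorem network_eq_inner_of_gate_eq {z u : EuclideanSpace ℝ (Fin d)}
    (hg : ∀ h, gate ((Wᵀ *ᵥ u.ofLp) h) (b h) = gate ((Wᵀ *ᵥ z.ofLp) h) (b h)) :
    network a W b u = inner ℝ (gatedWeights a W b z) u := by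
  simp only [PiLp.inner_apply, gatedWeights_apply, network, gatedActivation, hg]
  simp only [Matrix.mulVec, dotProduct, Matrix.transpose_apply, RCLike.inner_apply, conj_trivial, Finset.mul_sum,
    Finset.sum_mul]
  rw [Finset.sum_comm]
  exact Finset.sum_congr rfl fun i _ => Finset.sum_congr rfl fun h _ => by ring

/-- If no gate switches on the ball of radius `r ≥ ε` around `z`, the network is linear there,
and the increase of the loss caused by the attack is its linear part up to the curvature of the
loss. -/
theorem abs_lossIncrease_sub_le {l : ℝ → ℝ → ℝ} {ε r y : ℝ} {L : ℝ≥0}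
    {z : EuclideanSpace ℝ (Fin d)} (hε : 0 ≤ ε) (hεr : ε ≤ r) (hr : 0 < r)
    (hstab : ∀ u, ‖u - z‖ ≤ r → ∀ h,
      gate ((Wᵀ *ᵥ u.ofLp) h) (b h) = gate ((Wᵀ *ᵥ z.ofLp) h) (b h))
    (hdiff : ∀ s ∈ Set.uIcc (network a W b z) (network a W b (z + fgmAttack l ε a W b z y)),
      DifferentiableAt ℝ (fun t => l t y) s)
    (hlip : LipschitzOnWith L (deriv fun t => l t y)
      (Set.uIcc (network a W b z) (network a W b (z + fgmAttack l ε a W b z y)))) :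
    |lossIncrease l ε a W b z y
        - ε * |deriv (fun t => l t y) (network a W b z)| * ‖gatedWeights a W b z‖|
      ≤ L / 2 * (ε * ‖gatedWeights a W b z‖) ^ 2 := by
  set g := gatedWeights a W b z with hg
  set φ : ℝ → ℝ := fun t => l t y with hφ
  set p := deriv φ (network a W b z) with hp
  have hlin : ∀ u, ‖u - z‖ ≤ r → network a W b u = inner ℝ g u := fun u hu =>
    network_eq_inner_of_gate_eq (hstab u hu)
  have hz : network a W b z = inner ℝ g z := hlin z (by simpa using hr.le)
  have hgrad : gradient (fun u => l (network a W b u) y) z = p • g := by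
    have h1 : HasFDerivAt (network a W b) (InnerProductSpace.toDual ℝ _ g) z := by
      refine (InnerProductSpace.toDual ℝ _ g).hasFDerivAt.congr_of_eventuallyEq ?_
      filter_upwards [Metric.closedBall_mem_nhds z hr] with u hu
      rw [hlin u (by simpa [dist_eq_norm] using hu), InnerProductSpace.toDual_apply_apply]
    have h2 : HasDerivAt φ p (network a W b z) := (hdiff _ Set.left_mem_uIcc).hasDerivAt
    have h3 := h2.comp_hasFDerivAt z h1
    refine HasGradientAt.gradient (hasGradientAt_iff_hasFDerivAt.mpr ?_)
    rw [show InnerProductSpace.toDual ℝ _ (p • g) = p • InnerProductSpace.toDual ℝ _ g by simp]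
    exact h3
  have hδ : fgmAttack l ε a W b z y = (ε / ‖p • g‖) • (p • g) := by rw [fgmAttack, hgrad]
  have hδnorm : ‖fgmAttack l ε a W b z y‖ ≤ r := by
    rw [hδ, norm_smul, norm_div, norm_norm, Real.norm_of_nonneg hε]
    rcases eq_or_ne ‖p • g‖ 0 with h0 | h0
    · rw [h0]; simpa using hr.le
    · rwa [div_mul_cancel₀ _ h0]
  have hout : network a W b (z + fgmAttack l ε a W b z y) - network a W b z
      = ε / ‖p • g‖ * (p * ‖g‖ ^ 2) := by
    rw [hlin _ (by simpa using hδnorm), hz, inner_add_right, add_sub_cancel_left, hδ,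
      inner_smul_right, inner_smul_right, real_inner_self_eq_norm_sq]
  have htaylor := abs_sub_sub_deriv_mul_le_of_lipschitzOnWith hdiff hlip
  rw [← hp, hout] at htaylor
  have hlin_term : p * (ε / ‖p • g‖ * (p * ‖g‖ ^ 2)) = ε * |p| * ‖g‖ := by
    rw [norm_smul, Real.norm_eq_abs]
    -- if the gradient vanishes, the attack is `0` by the convention `ε / 0 = 0`
    rcases eq_or_ne p 0 with h0 | h0
    · simp [h0]
    rcases eq_or_ne ‖g‖ 0 with h1 | h1
    · simp [h1]
    have := abs_pos.mpr h0
    field_simp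
    rw [sq_abs]
    ring
  have hquad : (ε / ‖p • g‖ * (p * ‖g‖ ^ 2)) ^ 2 ≤ (ε * ‖g‖) ^ 2 := by
    rw [norm_smul, Real.norm_eq_abs]
    rcases eq_or_ne p 0 with h0 | h0
    · simp [h0]; positivity
    rcases eq_or_ne ‖g‖ 0 with h1 | h1
    · simp [h1]
    have := abs_pos.mpr h0
    refine le_of_eq ?_
    field_simp
    rw [sq_abs]
  rw [hlin_term] at htaylor
  refine le_trans (by simpa [lossIncrease] using htaylor) ?_
  gcongr

end Attack

/-! ### Typical realizations -/

section Typical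

variable {d H : ℕ}

/-- Node `h` is hit by `x` when the support of the column `U_h` meets the support of `x`. -/
def IsHit (U : Matrix (Fin d) (Fin H) ℝ) (x : EuclideanSpace ℝ (Fin d)) (h : Fin H) : Prop :=
  ∃ i, U i h ≠ 0 ∧ x i ≠ 0

/-- The deterministic part of the regime: thresholds are positive, but at most half of the
contribution to a node of a single feature of size `κ`, and the nodes using a given feature use it
with the same sign. -/
structure IsSeparated (κ : ℝ) (U : Matrix (Fin d) (Fin H) ℝ) (b : Fin H → ℝ) : Prop where
  threshold_pos : ∀ h, 0 < b h
  two_mul_threshold_le : ∀ i h, U i h ≠ 0 → 2 * b h ≤ |U i h| * κ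
  same_sign : ∀ i h h', 0 ≤ U i h * U i h'

/-- A realization `(x, ξ)` is typical when no node sees two active features, active features have
size at least `κ`, and the noise moves the input of a node by at most half its threshold. -/
structure IsTypical (κ : ℝ) (U W : Matrix (Fin d) (Fin H) ℝ) (b : Fin H → ℝ)
    (x ξ : EuclideanSpace ℝ (Fin d)) : Prop where
  overlap : ∀ h i j, U i h ≠ 0 → U j h ≠ 0 → x i ≠ 0 → x j ≠ 0 → i = j
  amplitude : ∀ i, x i ≠ 0 → κ ≤ |x i|
  noise : ∀ h, |(Wᵀ *ᵥ ξ.ofLp) h| ≤ b h / 2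

variable {κ : ℝ} {U W : Matrix (Fin d) (Fin H) ℝ} {M : Matrix (Fin d) (Fin d) ℝ} {b : Fin H → ℝ}
  {x ξ : EuclideanSpace ℝ (Fin d)}

theorem transpose_mulVec_eq_zero_of_not_isHit {h : Fin H} (hh : ¬ IsHit U x h) :
    (Uᵀ *ᵥ x.ofLp) h = 0 := by
  simp only [Matrix.mulVec, dotProduct, Matrix.transpose_apply]
  refine Finset.sum_eq_zero fun i _ => ?_
  by_contra hne
  exact hh ⟨i, left_ne_zero_of_mul hne, right_ne_zero_of_mul hne⟩

theorem IsTypical.two_mul_threshold_le (ht : IsTypical κ U W b x ξ) (hs : IsSeparated κ U b)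
    {h : Fin H} (hh : IsHit U x h) : 2 * b h ≤ |(Uᵀ *ᵥ x.ofLp) h| := by
  obtain ⟨i, hU, hx⟩ := hh
  have hsum : (Uᵀ *ᵥ x.ofLp) h = U i h * x i := by
    simp only [Matrix.mulVec, dotProduct, Matrix.transpose_apply]
    refine Finset.sum_eq_single i (fun j _ hji => ?_) (by simp)
    by_contra hne
    exact hji (ht.overlap h j i (left_ne_zero_of_mul hne) hU (right_ne_zero_of_mul hne) hx)
  rw [hsum, abs_mul]
  exact (hs.two_mul_threshold_le i h hU).trans
    (mul_le_mul_of_nonneg_left (ht.amplitude i hx) (abs_nonneg _))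

theorem IsTypical.threshold_le_iff_isHit (ht : IsTypical κ U W b x ξ) (hs : IsSeparated κ U b)
    (h : Fin H) : b h ≤ |(Uᵀ *ᵥ x.ofLp) h| ↔ IsHit U x h := by
  have hb := hs.threshold_pos h
  refine ⟨fun hle => ?_, fun hh => by linarith [ht.two_mul_threshold_le hs hh]⟩
  by_contra hh
  rw [transpose_mulVec_eq_zero_of_not_isHit hh, abs_zero] at hle
  linarith

/-- No node input, for noisy features, lies within half a threshold of the threshold: hence a
perturbation that moves it by at most a quarter does not switch the gate. -/
theorem IsTypical.threshold_le_iff_isHit_of_near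
    (ht : IsTypical κ (Mᵀ * W) W b x ξ) (hs : IsSeparated κ (Mᵀ * W) b) (h : Fin H) {v : ℝ}
    (hv : |v - (Wᵀ *ᵥ (observed M x ξ).ofLp) h| ≤ b h / 4) :
    b h ≤ |v| ↔ IsHit (Mᵀ * W) x h := by
  rw [transpose_mulVec_observed] at hv
  have hb := hs.threshold_pos h
  have hn := abs_le.mp (ht.noise h)
  have hv' := abs_le.mp hv
  by_cases hh : IsHit (Mᵀ * W) x h
  · have h2 := ht.two_mul_threshold_le hs hh
    simp only [hh, iff_true]
    rcases le_abs'.mp h2 with h3 | h3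
    · exact le_abs'.mpr (Or.inl (by linarith))
    · exact le_abs'.mpr (Or.inr (by linarith))
  · rw [transpose_mulVec_eq_zero_of_not_isHit hh] at hv'
    simp only [hh, iff_false, not_le]
    exact abs_lt.mpr ⟨by linarith, by linarith⟩

theorem IsTypical.threshold_le_observed_iff_isHit
    (ht : IsTypical κ (Mᵀ * W) W b x ξ) (hs : IsSeparated κ (Mᵀ * W) b) (h : Fin H) :
    b h ≤ |(Wᵀ *ᵥ (observed M x ξ).ofLp) h| ↔ IsHit (Mᵀ * W) x h :=
  ht.threshold_le_iff_isHit_of_near hs h (by simpa using by linarith [hs.threshold_pos h])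

/-- In a typical realization the noise does not change any gate. -/
theorem IsTypical.norm_gatedWeights_observed (hM : M ∈ Matrix.orthogonalGroup (Fin d) ℝ)
    (ht : IsTypical κ (Mᵀ * W) W b x ξ) (hs : IsSeparated κ (Mᵀ * W) b) (a : Fin H → ℝ) :
    ‖gatedWeights a W b (observed M x ξ)‖ = ‖gatedWeights a (Mᵀ * W) b x‖ := by
  refine norm_gatedWeights_eq_of_gate_eq hM fun h => ?_
  exact gate_congr
    ((ht.threshold_le_observed_iff_isHit hs h).trans (ht.threshold_le_iff_isHit hs h).symm)

theorem IsTypical.gate_eq_of_norm_sub_le {r : ℝ}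
    (ht : IsTypical κ (Mᵀ * W) W b x ξ) (hs : IsSeparated κ (Mᵀ * W) b)
    (hr : ∀ h, colNorm W h * r ≤ b h / 4) {u : EuclideanSpace ℝ (Fin d)}
    (hu : ‖u - observed M x ξ‖ ≤ r) (h : Fin H) :
    gate ((Wᵀ *ᵥ u.ofLp) h) (b h) = gate ((Wᵀ *ᵥ (observed M x ξ).ofLp) h) (b h) := by
  have hnear : |(Wᵀ *ᵥ u.ofLp) h - (Wᵀ *ᵥ (observed M x ξ).ofLp) h| ≤ b h / 4 := by
    have h1 := abs_transpose_mulVec_le W (u - observed M x ξ) h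
    rw [WithLp.ofLp_sub, Matrix.mulVec_sub, Pi.sub_apply] at h1
    exact h1.trans ((mul_le_mul_of_nonneg_left hu (norm_nonneg _)).trans (hr h))
  exact gate_congr ((ht.threshold_le_iff_isHit_of_near hs h hnear).trans
    (ht.threshold_le_observed_iff_isHit hs h).symm)

/-! ### Norms of the gated weights -/

theorem abs_gatedWeights_one (hsign : ∀ i h h', 0 ≤ U i h * U i h')
    (x : EuclideanSpace ℝ (Fin d)) (i : Fin d) :
    |gatedWeights (fun _ => 1) U b x i|
      = ∑ h, gate ((Uᵀ *ᵥ x.ofLp) h) (b h) * |U i h| := by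
  rw [gatedWeights_apply]
  simp only [one_mul]
  exact abs_sum_mul_of_same_sign (hsign i) fun h => gate_nonneg _ _

theorem abs_mulVec_one (hsign : ∀ i h h', 0 ≤ U i h * U i h') (i : Fin d) :
    |(U *ᵥ fun _ => 1) i| = ∑ h, |U i h| := by
  have := abs_sum_mul_of_same_sign (g := fun _ => 1) (hsign i) fun _ => zero_le_one
  simpa [Matrix.mulVec, dotProduct] using this

theorem abs_gatedWeights_one_le (hsign : ∀ i h h', 0 ≤ U i h * U i h')
    (x : EuclideanSpace ℝ (Fin d)) (i : Fin d) :
    |gatedWeights (fun _ => 1) U b x i| ≤ |(U *ᵥ fun _ => 1) i| := by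
  rw [abs_gatedWeights_one hsign, abs_mulVec_one hsign]
  exact Finset.sum_le_sum fun h _ => mul_le_of_le_one_left (abs_nonneg _) (gate_le_one _ _)

theorem norm_gatedWeights_one_le (hsign : ∀ i h h', 0 ≤ U i h * U i h')
    (x : EuclideanSpace ℝ (Fin d)) :
    ‖gatedWeights (fun _ => 1) U b x‖
      ≤ ‖(WithLp.toLp 2 (U *ᵥ fun _ => 1) : EuclideanSpace ℝ (Fin d))‖ :=
  EuclideanSpace.norm_le_norm_of_abs_le (abs_gatedWeights_one_le hsign x)

/-- At an active feature every node using it is activated, so nothing is lost there. -/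
theorem IsTypical.gatedWeights_of_ne_zero (ht : IsTypical κ U W b x ξ) (hs : IsSeparated κ U b)
    {i : Fin d} (hi : x i ≠ 0) : gatedWeights (fun _ => 1) U b x i = (U *ᵥ fun _ => 1) i := by
  rw [gatedWeights_apply]
  refine Finset.sum_congr rfl fun h _ => ?_
  rcases eq_or_ne (U i h) 0 with h0 | h0
  · simp [h0]
  · simp [gate_of_le ((ht.threshold_le_iff_isHit hs h).mpr ⟨i, h0, hi⟩)]

theorem restrictActive_of_ne_zero {θ : EuclideanSpace ℝ (Fin d)} {i : Fin d} (hi : x i ≠ 0) :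
    restrictActive θ x i = θ i :=
  Set.indicator_of_mem (s := {i | x i ≠ 0}) hi _

theorem restrictActive_of_eq_zero {θ : EuclideanSpace ℝ (Fin d)} {i : Fin d} (hi : x i = 0) :
    restrictActive θ x i = 0 :=
  Set.indicator_of_notMem (s := {i | x i ≠ 0}) (by simpa using hi) _

theorem IsTypical.abs_restrictActive_le (ht : IsTypical κ U W b x ξ) (hs : IsSeparated κ U b)
    (i : Fin d) :
    |restrictActive (WithLp.toLp 2 (U *ᵥ fun _ => 1)) x i|
      ≤ |gatedWeights (fun _ => 1) U b x i| := by
  rcases eq_or_ne (x i) 0 with hi | hi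
  · simp [restrictActive_of_eq_zero hi]
  · rw [restrictActive_of_ne_zero hi, ht.gatedWeights_of_ne_zero hs hi]

theorem IsTypical.norm_restrictActive_le (ht : IsTypical κ U W b x ξ) (hs : IsSeparated κ U b) :
    ‖restrictActive (WithLp.toLp 2 (U *ᵥ fun _ => 1)) x‖ ≤ ‖gatedWeights (fun _ => 1) U b x‖ :=
  EuclideanSpace.norm_le_norm_of_abs_le (ht.abs_restrictActive_le hs)

/-- Equality in the lower bound means that no activated node leaks weight to an inactive feature;
since an activated node sees exactly one active feature, this feature is all of its support. -/
theorem IsTypical.norm_restrictActive_eq_iff (ht : IsTypical κ U W b x ξ)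
    (hs : IsSeparated κ U b) :
    ‖restrictActive (WithLp.toLp 2 (U *ᵥ fun _ => 1)) x‖ = ‖gatedWeights (fun _ => 1) U b x‖ ↔
      ∀ h, b h ≤ |(Uᵀ *ᵥ x.ofLp) h| → colNorm0 U h ≤ 1 := by
  rw [EuclideanSpace.norm_eq_norm_iff_of_abs_le (ht.abs_restrictActive_le hs)]
  constructor
  · intro heq h hact
    obtain ⟨i₀, hU₀, hx₀⟩ := (ht.threshold_le_iff_isHit hs h).mp hact
    have hactive : ∀ i, U i h ≠ 0 → x i ≠ 0 := by
      intro i hU hx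
      have h1 := heq i
      rw [restrictActive_of_eq_zero hx, abs_zero, abs_gatedWeights_one hs.same_sign, eq_comm,
        Finset.sum_eq_zero_iff_of_nonneg
          (fun h _ => mul_nonneg (gate_nonneg _ _) (abs_nonneg _))] at h1
      have h2 := h1 h (Finset.mem_univ h)
      rw [gate_of_le hact, one_mul, abs_eq_zero] at h2
      exact hU h2
    refine (Set.ncard_le_one (Set.toFinite _)).mpr fun i hi j hj => ?_
    exact ht.overlap h i j hi hj (hactive i hi) (hactive j hj)
  · intro hpure i
    rcases eq_or_ne (x i) 0 with hi | hi
    · rw [restrictActive_of_eq_zero hi, abs_zero, abs_gatedWeights_one hs.same_sign]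
      refine (Finset.sum_eq_zero fun h _ => ?_).symm
      by_cases hact : b h ≤ |(Uᵀ *ᵥ x.ofLp) h|
      · obtain ⟨i₀, hU₀, hx₀⟩ := (ht.threshold_le_iff_isHit hs h).mp hact
        have hU : U i h = 0 := by
          by_contra hU
          have := (Set.ncard_le_one (Set.toFinite _)).mp (hpure h hact) i hU i₀ hU₀
          exact hx₀ (this ▸ hi)
        simp [hU]
      · rw [gate_of_lt (not_le.mp hact), zero_mul]
    · rw [restrictActive_of_ne_zero hi, ht.gatedWeights_of_ne_zero hs hi]

/-- Every activated node hits an active feature, at which it spends a fixed fraction of its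
`ℓ¹`-mass divided by the size of its support. So the total mass of the activated nodes is
controlled by the number of active features. -/
theorem IsTypical.sq_norm_gatedWeights_le (ht : IsTypical κ U W b x ξ) (hs : IsSeparated κ U b)
    {T K m : ℝ} (hT : ∀ i, |(U *ᵥ fun _ => 1) i| ≤ T) (hT0 : 0 ≤ T) (hK : 0 ≤ K) (hm0 : 0 ≤ m)
    (hm : ∀ h, (colNorm0 U h : ℝ) ≤ m)
    (hcomp : ∀ i j h, U j h ≠ 0 → |U i h| ≤ K * |U j h|) :
    ‖gatedWeights (fun _ => 1) U b x‖ ^ 2 ≤ T * (m * K * (T * (Set.ncard {i | x i ≠ 0} : ℝ))) := by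
  classical
  set g : Fin H → ℝ := fun h => gate ((Uᵀ *ᵥ x.ofLp) h) (b h) with hg
  set A : Finset (Fin d) := Finset.univ.filter fun i => x i ≠ 0 with hA
  have hcard : (Set.ncard {i | x i ≠ 0} : ℝ) = A.card := by
    rw [← Set.ncard_coe_finset]; simp [hA]
  have hnode : ∀ h, g h * ∑ i, |U i h| ≤ m * K * ∑ i ∈ A, |U i h| := by
    intro h
    by_cases hact : b h ≤ |(Uᵀ *ᵥ x.ofLp) h|
    · obtain ⟨j, hUj, hxj⟩ := (ht.threshold_le_iff_isHit hs h).mp hact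
      have h1 : ∑ i, |U i h| ≤ colNorm0 U h * (K * |U j h|) := by
        have hsupp : ∑ i, |U i h| = ∑ i ∈ Finset.univ.filter (fun i => U i h ≠ 0), |U i h| := by
          rw [Finset.sum_filter_of_ne]
          intro i _ hi; simpa using hi
        have hc : colNorm0 U h = (Finset.univ.filter (fun i => U i h ≠ 0)).card := by
          rw [colNorm0, ← Set.ncard_coe_finset]; simp
        rw [hsupp, hc, ← nsmul_eq_mul]
        exact Finset.sum_le_card_nsmul _ _ _ fun i _ => hcomp i j h hUj
      have h2 : |U j h| ≤ ∑ i ∈ A, |U i h| :=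
        Finset.single_le_sum (f := fun i => |U i h|) (fun _ _ => abs_nonneg _)
          (by simpa [hA] using hxj)
      calc g h * ∑ i, |U i h| = ∑ i, |U i h| := by simp only [hg, gate_of_le hact, one_mul]
        _ ≤ colNorm0 U h * (K * |U j h|) := h1
        _ ≤ m * (K * ∑ i ∈ A, |U i h|) := by
          gcongr
          exact hm h
        _ = m * K * ∑ i ∈ A, |U i h| := by ring
    · simp only [hg, gate_of_lt (not_le.mp hact), zero_mul]
      positivity
  rw [EuclideanSpace.real_norm_sq_eq]
  calc ∑ i, gatedWeights (fun _ => 1) U b x i ^ 2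
      ≤ ∑ i, T * ∑ h, g h * |U i h| := by
        refine Finset.sum_le_sum fun i _ => ?_
        rw [← sq_abs, sq, ← abs_gatedWeights_one hs.same_sign]
        gcongr
        exact (abs_gatedWeights_one_le hs.same_sign x i).trans (hT i)
    _ = T * ∑ h, g h * ∑ i, |U i h| := by
        rw [← Finset.mul_sum, Finset.sum_comm]
        simp only [Finset.mul_sum]
    _ ≤ T * ∑ h, m * K * ∑ i ∈ A, |U i h| := by
        exact mul_le_mul_of_nonneg_left (Finset.sum_le_sum fun h _ => hnode h) hT0
    _ = T * (m * K * ∑ i ∈ A, |(U *ᵥ fun _ => 1) i|) := by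
        rw [← Finset.mul_sum, Finset.sum_comm]
        simp only [abs_mulVec_one hs.same_sign]
    _ ≤ T * (m * K * (T * (Set.ncard {i | x i ≠ 0} : ℝ))) := by
        gcongr
        rw [hcard, mul_comm, ← nsmul_eq_mul]
        exact Finset.sum_le_card_nsmul _ _ _ fun i _ => hT i

end Typical

/-! ### Probability estimates for a fixed dimension -/

section Probability

variable {Ω : Type*} [MeasurableSpace Ω] {μ : Measure Ω} {d : ℕ}

theorem measureReal_exists_le_sum {ι : Type*} [Fintype ι] (E : ι → Ω → Prop) :
    μ.real {ω | ∃ i, E i ω} ≤ ∑ i, μ.real {ω | E i ω} := by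
  have : {ω | ∃ i, E i ω} = ⋃ i, {ω | E i ω} := by ext; simp
  rw [this]
  exact measureReal_iUnion_fintype_le _

theorem hasSubgaussianMGF_of_map_eq_gaussianReal {Y : Ω → ℝ} (hY : AEMeasurable Y μ) {v : ℝ≥0}
    (h : μ.map Y = gaussianReal 0 v) : HasSubgaussianMGF Y v μ where
  integrable_exp_mul t := by
    have := integrable_exp_mul_gaussianReal (μ := 0) (v := v) t
    rw [← h, integrable_map_measure (by fun_prop) hY] at this
    exact this
  mgf_le t := by rw [mgf_gaussianReal h]; simp

variable [IsProbabilityMeasure μ]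

/-- Two coordinates in a set of `s` coordinates are simultaneously nonzero with probability at most
`(s p)²`, when each one is nonzero with probability at most `p`. -/
theorem measureReal_exists_pair_ne_zero_le {X : Ω → EuclideanSpace ℝ (Fin d)}
    (hind : iIndepFun (fun i ω => X ω i) μ) {p : ℝ} (hp : ∀ i, μ.real {ω | X ω i ≠ 0} ≤ p)
    (S : Set (Fin d)) :
    μ.real {ω | ∃ i j, i ∈ S ∧ j ∈ S ∧ X ω i ≠ 0 ∧ X ω j ≠ 0 ∧ i ≠ j} ≤ (S.ncard * p) ^ 2 := by
  classical
  have hpair : ∀ i j, i ≠ j → μ.real {ω | X ω i ≠ 0 ∧ X ω j ≠ 0} ≤ p ^ 2 := by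
    intro i j hij
    have hm : MeasurableSet ({0}ᶜ : Set ℝ) := (measurableSet_singleton 0).compl
    have := (hind.indepFun hij).measure_inter_preimage_eq_mul _ _ hm hm
    have h2 : μ.real {ω | X ω i ≠ 0 ∧ X ω j ≠ 0}
        = μ.real {ω | X ω i ≠ 0} * μ.real {ω | X ω j ≠ 0} := by
      simp only [measureReal_def, ← ENNReal.toReal_mul]
      congr 1
    rw [h2, sq]
    exact mul_le_mul (hp i) (hp j) measureReal_nonneg (measureReal_nonneg.trans (hp i))
  have hbound : ∀ q : Fin d × Fin d,
      μ.real {ω | q.1 ∈ S ∧ q.2 ∈ S ∧ X ω q.1 ≠ 0 ∧ X ω q.2 ≠ 0 ∧ q.1 ≠ q.2}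
        ≤ if q ∈ S.toFinset ×ˢ S.toFinset then p ^ 2 else 0 := by
    rintro ⟨i, j⟩
    by_cases hS : i ∈ S ∧ j ∈ S ∧ i ≠ j
    · rw [if_pos (by simp [hS])]
      refine (measureReal_mono ?_).trans (hpair i j hS.2.2)
      exact fun ω hω => ⟨hω.2.2.1, hω.2.2.2.1⟩
    · have h0 : {ω | i ∈ S ∧ j ∈ S ∧ X ω i ≠ 0 ∧ X ω j ≠ 0 ∧ i ≠ j} = ∅ := by
        ext ω; simp only [Set.mem_ofPred_eq, Set.mem_empty_iff_false, iff_false]; tauto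
      rw [h0, measureReal_empty]
      split_ifs <;> positivity
  have hset : {ω | ∃ i j, i ∈ S ∧ j ∈ S ∧ X ω i ≠ 0 ∧ X ω j ≠ 0 ∧ i ≠ j}
      = {ω | ∃ q : Fin d × Fin d,
          q.1 ∈ S ∧ q.2 ∈ S ∧ X ω q.1 ≠ 0 ∧ X ω q.2 ≠ 0 ∧ q.1 ≠ q.2} := by
    ext ω; simp [Prod.exists]
  rw [hset]
  refine (measureReal_exists_le_sum _).trans ((Finset.sum_le_sum fun q _ => hbound q).trans ?_)
  rw [Finset.sum_ite_mem, Finset.univ_inter, Finset.sum_const, Finset.card_product,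
    ← Set.ncard_eq_toFinset_card']
  simp only [nsmul_eq_mul, Nat.cast_mul]
  apply le_of_eq
  ring

/-- Gaussian tail of a linear combination of independent centered Gaussian variables of
variance `v`. -/
theorem measureReal_lt_abs_sum_gaussian_le {ξ : Fin d → Ω → ℝ} (hmeas : ∀ i, AEMeasurable (ξ i) μ)
    (hind : iIndepFun ξ μ) {v : ℝ≥0} (hlaw : ∀ i, μ.map (ξ i) = gaussianReal 0 v)
    (w : Fin d → ℝ) {t : ℝ} (ht : 0 ≤ t) :
    μ.real {ω | t < |∑ i, w i * ξ i ω|}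
      ≤ 2 * Real.exp (-t ^ 2 / (2 * ((∑ i, w i ^ 2) * v))) := by
  have hsub : HasSubgaussianMGF (fun ω => ∑ i, w i * ξ i ω)
      (∑ i, NNReal.mk (w i ^ 2) (sq_nonneg _) * v) μ := by
    refine HasSubgaussianMGF.sum_of_iIndepFun (X := fun i ω => w i * ξ i ω) ?_ fun i _ => ?_
    · exact hind.comp (fun i y => w i * y) fun i => measurable_const_mul (w i)
    · exact (hasSubgaussianMGF_of_map_eq_gaussianReal (hmeas i) (hlaw i)).const_mul (w i)
  have hc : ((∑ i, NNReal.mk (w i ^ 2) (sq_nonneg _) * v : ℝ≥0) : ℝ) = (∑ i, w i ^ 2) * v := by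
    simp [Finset.sum_mul]
  have h1 := hsub.measure_ge_le ht
  have h2 := hsub.neg.measure_ge_le ht
  rw [hc] at h1 h2
  have hle : {ω | t < |∑ i, w i * ξ i ω|}
      ⊆ {ω | t ≤ ∑ i, w i * ξ i ω} ∪ {ω | t ≤ (-fun ω => ∑ i, w i * ξ i ω) ω} := by
    intro ω hω
    rw [Set.mem_ofPred_eq] at hω
    rcases lt_abs.mp hω with h | h
    · exact Or.inl h.le
    · exact Or.inr h.le
  refine (measureReal_mono hle).trans ((measureReal_union_le _ _).trans ?_)
  linarith

/-- Markov's inequality for the number of nonzero coordinates. -/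
theorem measureReal_lt_ncard_ne_zero_le {X : Ω → EuclideanSpace ℝ (Fin d)} (hX : Measurable X)
    {p : ℝ} (hp : ∀ i, μ.real {ω | X ω i ≠ 0} ≤ p) {t : ℝ} (ht : 0 < t) :
    μ.real {ω | t < (Set.ncard {i | X ω i ≠ 0} : ℝ)} ≤ d * p / t := by
  classical
  have hmeas : ∀ i, MeasurableSet {ω | X ω i ≠ 0} := fun i => by
    have : Measurable fun ω => X ω i := by fun_prop
    exact (this (measurableSet_singleton 0)).compl
  have hcount : ∀ ω, (Set.ncard {i | X ω i ≠ 0} : ℝ)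
      = ∑ i, Set.indicator {ω | X ω i ≠ 0} (fun _ => (1 : ℝ)) ω := by
    intro ω
    rw [Set.ncard_eq_toFinset_card']
    simp [Set.indicator_apply, Finset.sum_ite]
  have hint : ∀ i, Integrable (Set.indicator {ω | X ω i ≠ 0} fun _ => (1 : ℝ)) μ := fun i =>
    (integrable_const 1).indicator (hmeas i)
  have hmarkov := mul_meas_ge_le_integral_of_nonneg (μ := μ)
    (f := fun ω => ∑ i, Set.indicator {ω | X ω i ≠ 0} (fun _ => (1 : ℝ)) ω)
    (ae_of_all _ fun ω => Finset.sum_nonneg fun i _ =>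
      Set.indicator_nonneg (fun _ _ => zero_le_one) _) (integrable_finsetSum _ fun i _ => hint i) t
  rw [integral_finsetSum _ fun i _ => hint i] at hmarkov
  have hsum : ∑ i, ∫ ω, Set.indicator {ω | X ω i ≠ 0} (fun _ => (1 : ℝ)) ω ∂μ ≤ d * p := by
    calc _ ≤ ∑ _i : Fin d, p := by
          refine Finset.sum_le_sum fun i _ => ?_
          rw [integral_indicator_const _ (hmeas i)]
          simpa using hp i
      _ = d * p := by simp
  rw [le_div_iff₀ ht, mul_comm]
  refine le_trans ?_ (hmarkov.trans hsum)
  refine mul_le_mul_of_nonneg_left (measureReal_mono fun ω hω => ?_) ht.le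
  simp only [Set.mem_ofPred_eq, ← hcount]
  exact le_of_lt hω

/-- With positive probability a prescribed coordinate is the only nonzero one. -/
theorem measure_support_eq_singleton_pos {X : Ω → EuclideanSpace ℝ (Fin d)} (hX : Measurable X)
    (hind : iIndepFun (fun i ω => X ω i) μ) (hpos : ∀ i, 0 < μ.real {ω | X ω i ≠ 0})
    (hlt : ∀ i, μ.real {ω | X ω i ≠ 0} < 1) (i : Fin d) :
    0 < μ {ω | ∀ j, X ω j ≠ 0 ↔ j = i} := by
  classical
  set s : Fin d → Set ℝ := fun j => if j = i then {0}ᶜ else {0} with hs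
  have hsm : ∀ j, MeasurableSet (s j) := by
    intro j
    simp only [hs]
    split_ifs
    · exact (measurableSet_singleton 0).compl
    · exact measurableSet_singleton 0
  have heq : {ω | ∀ j, X ω j ≠ 0 ↔ j = i}
      = ⋂ j ∈ (Finset.univ : Finset (Fin d)), (fun ω => X ω j) ⁻¹' s j := by
    ext ω
    simp only [Set.mem_ofPred_eq, Finset.mem_univ, Set.iInter_true, Set.mem_iInter, Set.mem_preimage,
      hs]
    refine forall_congr' fun j => ?_
    by_cases hj : j = i <;> simp [hj]
  rw [heq, hind.measure_inter_preimage_eq_mul Finset.univ fun j _ => hsm j, pos_iff_ne_zero,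
    Finset.prod_ne_zero_iff]
  intro j _ h0
  have hmeas : MeasurableSet {ω | X ω j ≠ 0} := by
    have : Measurable fun ω => X ω j := by fun_prop
    exact (this (measurableSet_singleton 0)).compl
  by_cases hj : j = i
  · have h1 := hpos j
    rw [measureReal_def, show {ω | X ω j ≠ 0} = (fun ω => X ω j) ⁻¹' s j by ext; simp [hs, hj],
      h0] at h1
    simp at h1
  · have h1 := probReal_compl_eq_one_sub (μ := μ) hmeas
    rw [measureReal_def, show {ω | X ω j ≠ 0}ᶜ = (fun ω => X ω j) ⁻¹' s j by ext; simp [hs, hj],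
      h0] at h1
    simp only [ENNReal.toReal_zero] at h1
    linarith [hlt j]

end Probability

/-! ### Events of high probability -/

section HighProbability

variable {Ω : ℕ → Type*} [∀ n, MeasurableSpace (Ω n)] {P : (n : ℕ) → Measure (Ω n)}

theorem withHighProb_of_forall_measureReal_le [∀ n, IsFiniteMeasure (P n)]
    {E : (n : ℕ) → Ω n → Prop}
    (h : ∀ c > 0, ∀ᶠ n in atTop, (P n).real {ω | ¬ E n ω} ≤ c) : WithHighProb P E := by
  have hreal : Tendsto (fun n => (P n).real {ω | ¬ E n ω}) atTop (𝓝 0) := by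
    rw [Metric.tendsto_nhds]
    intro ε hε
    filter_upwards [h (ε / 2) (half_pos hε)] with n hn
    rw [Real.dist_eq, sub_zero, abs_of_nonneg measureReal_nonneg]
    linarith
  exact (ENNReal.tendsto_toReal_iff (fun n => measure_ne_top _ _) ENNReal.zero_ne_top).mp
    (by simpa [measureReal_def] using hreal)

theorem WithHighProb.mono {E F : (n : ℕ) → Ω n → Prop} (hE : WithHighProb P E)
    (h : ∀ᶠ n in atTop, ∀ ω, E n ω → F n ω) : WithHighProb P F := by
  refine tendsto_of_tendsto_of_tendsto_of_le_of_le' tendsto_const_nhds hE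
    (Eventually.of_forall fun _ => zero_le) ?_
  filter_upwards [h] with n hn
  exact measure_mono fun ω hω hE => hω (hn ω hE)

theorem WithHighProb.and {E F : (n : ℕ) → Ω n → Prop} (hE : WithHighProb P E)
    (hF : WithHighProb P F) : WithHighProb P fun n ω => E n ω ∧ F n ω := by
  have hadd := Tendsto.add hE hF
  rw [add_zero] at hadd
  refine tendsto_of_tendsto_of_tendsto_of_le_of_le tendsto_const_nhds hadd
    (fun _ => zero_le) fun n => ?_
  refine (measure_mono fun ω hω => ?_).trans (measure_union_le _ _)
  by_cases h1 : E n ω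
  · exact Or.inr fun h2 => hω ⟨h1, h2⟩
  · exact Or.inl h1

theorem withHighProb_of_forall_ae {E : (n : ℕ) → Ω n → Prop} (h : ∀ n, ∀ᵐ ω ∂(P n), E n ω) :
    WithHighProb P E := by
  have : (fun n => P n {ω | ¬ E n ω}) = fun _ => 0 := funext fun n => h n
  rw [WithHighProb, this]
  exact tendsto_const_nhds

/-- Union bound over an index-dependent finite family of size `N n`, whose bad events have
probability `o(1 / N n)`. -/
theorem withHighProb_forall_of_measureReal_le [∀ n, IsFiniteMeasure (P n)] {N : ℕ → ℕ}
    {E : (n : ℕ) → Fin (N n) → Ω n → Prop}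
    (h : ∀ c > 0, ∀ᶠ n in atTop, ∀ i, N n * (P n).real {ω | ¬ E n i ω} ≤ c) :
    WithHighProb P fun n ω => ∀ i, E n i ω := by
  refine withHighProb_of_forall_measureReal_le fun c hc => ?_
  filter_upwards [h c hc] with n hn
  have hset : {ω | ¬ ∀ i, E n i ω} = ⋃ i, {ω | ¬ E n i ω} := by ext; simp
  rw [hset]
  refine (measureReal_iUnion_fintype_le _).trans ?_
  rcases Nat.eq_zero_or_pos (N n) with h0 | h0
  · have : IsEmpty (Fin (N n)) := by rw [h0]; infer_instance
    simpa using hc.le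
  · have hpos : (0 : ℝ) < N n := by exact_mod_cast h0
    calc ∑ i, (P n).real {ω | ¬ E n i ω} ≤ ∑ _i : Fin (N n), c / N n :=
          Finset.sum_le_sum fun i _ => by rw [le_div_iff₀ hpos, mul_comm]; exact hn i
      _ = c := by simp; field_simp

end HighProbability

/-! ### Asymptotics of the network class -/

section Columns

variable {d H : ℕ} (V : Matrix (Fin d) (Fin H) ℝ) (h : Fin H)

theorem sq_colNorm : colNorm V h ^ 2 = ∑ i, V i h ^ 2 := by
  rw [colNorm, EuclideanSpace.real_norm_sq_eq]

variable {V h}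

theorem colNorm_pos {i : Fin d} (hi : V i h ≠ 0) : 0 < colNorm V h := by
  refine lt_of_le_of_ne (norm_nonneg _) fun h0 => ?_
  have := sq_colNorm V h
  rw [← h0, zero_pow two_ne_zero, eq_comm,
    Finset.sum_eq_zero_iff_of_nonneg fun _ _ => sq_nonneg _] at this
  exact hi (pow_eq_zero_iff two_ne_zero |>.mp (this i (Finset.mem_univ i)))

theorem one_le_colNorm0 {i : Fin d} (hi : V i h ≠ 0) : 1 ≤ colNorm0 V h :=
  (Set.ncard_pos (Set.toFinite _)).mpr ⟨i, hi⟩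

theorem colNorm_le_sqrt_mul {B : ℝ} (hB : 0 ≤ B) (hV : ∀ i, V i h ≠ 0 → |V i h| ≤ B) :
    colNorm V h ≤ √(colNorm0 V h) * B := by
  classical
  rw [← sq_le_sq₀ (by exact norm_nonneg _) (by positivity), sq_colNorm, mul_pow,
    Real.sq_sqrt (Nat.cast_nonneg _)]
  have hsupp : ∑ i, V i h ^ 2 = ∑ i ∈ Finset.univ.filter (fun i => V i h ≠ 0), V i h ^ 2 := by
    rw [Finset.sum_filter_of_ne]
    intro i _ hi; simpa using hi
  have hc : colNorm0 V h = (Finset.univ.filter (fun i => V i h ≠ 0)).card := by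
    rw [colNorm0, ← Set.ncard_coe_finset]; simp
  rw [hsupp, hc, ← nsmul_eq_mul]
  refine Finset.sum_le_card_nsmul _ _ _ fun i hi => ?_
  rw [← sq_abs]
  exact pow_le_pow_left₀ (abs_nonneg _) (hV i (by simpa using hi)) 2

end Columns

theorem eventually_le_log {d : ℕ → ℕ} (hd : Tendsto d atTop atTop) (B : ℝ) :
    ∀ᶠ n in atTop, B ≤ Real.log (d n) :=
  (Real.tendsto_log_atTop.comp (tendsto_natCast_atTop_atTop.comp hd)).eventually_ge_atTop B

theorem eventually_mul_log_pow_le {d : ℕ → ℕ} (hd : Tendsto d atTop atTop) (p : ℕ) (B : ℝ) :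
    ∀ᶠ n in atTop, B * Real.log (d n) ^ p ≤ d n := by
  have h := (Real.isLittleO_pow_log_id_atTop (n := p)).comp_tendsto
    (tendsto_natCast_atTop_atTop.comp hd)
  filter_upwards [h.bound (c := (|B| + 1)⁻¹) (by positivity), eventually_le_log hd 0] with n hn hl
  simp only [Function.comp_apply, id, norm_pow, Real.norm_natCast, Real.norm_of_nonneg hl] at hn
  have hB : 0 < |B| + 1 := by positivity
  rw [inv_mul_eq_div, le_div_iff₀ hB] at hn
  nlinarith [le_abs_self B, pow_nonneg hl p]

namespace NetworkClass

variable {d H : ℕ → ℕ} {k mstar γ : ℕ → ℝ} {M : (n : ℕ) → Matrix (Fin (d n)) (Fin (d n)) ℝ}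
  {W : (n : ℕ) → Matrix (Fin (d n)) (Fin (H n)) ℝ} {b : (n : ℕ) → Fin (H n) → ℝ}

theorem eventually_dim_le_width (hnet : NetworkClass d H k mstar γ M W b) :
    ∀ᶠ n in atTop, (d n : ℝ) ≤ H n := by
  filter_upwards [hnet.width.bound one_pos] with n hn
  simpa using hn

theorem eventually_featureBound_pos (hnet : NetworkClass d H k mstar γ M W b)
    (hd : Tendsto d atTop atTop) : ∀ᶠ n in atTop, 0 < mstar n := by
  filter_upwards [hnet.eventually_dim_le_width, hd.eventually_ge_atTop 1] with n hH hd1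
  have hd0 : (0 : ℝ) < d n := by exact_mod_cast hd1
  have hH0 : 0 < H n := by exact_mod_cast hd0.trans_le hH
  obtain ⟨i, hi⟩ := hnet.node_ne_zero n ⟨0, hH0⟩
  have : (0 : ℝ) < colNorm0 ((M n)ᵀ * W n) ⟨0, hH0⟩ := by exact_mod_cast one_le_colNorm0 hi
  exact this.trans_le (hnet.feature_count n _)

/-- The sparsity level is eventually positive, since otherwise the lower bound on the thresholds
required by the noise would vanish. -/
theorem eventually_sparsity_pos (hnet : NetworkClass d H k mstar γ M W b)
    (hd : Tendsto d atTop atTop) : ∀ᶠ n in atTop, 0 < k n := by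
  filter_upwards [hnet.eventually_dim_le_width, hd.eventually_ge_atTop 1,
    hnet.noise_level 1 one_pos] with n hH hd1 hlev
  by_contra hk
  push Not at hk
  have hd0 : (0 : ℝ) < d n := by exact_mod_cast hd1
  have hH0 : 0 < H n := by exact_mod_cast hd0.trans_le hH
  obtain ⟨i, hi⟩ := hnet.node_ne_zero n ⟨0, hH0⟩
  have h1 := hlev ⟨0, hH0⟩
  rw [Real.sqrt_eq_zero_of_nonpos (mul_nonpos_of_nonpos_of_nonneg hk (Nat.cast_nonneg _))] at h1
  have h2 : 0 < colNorm ((M n)ᵀ * W n) ⟨0, hH0⟩ / √(d n) :=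
    div_pos (colNorm_pos hi) (Real.sqrt_pos.mpr hd0)
  simp only [div_zero, zero_div, mul_zero] at h1
  linarith

theorem eventually_isSeparated (hnet : NetworkClass d H k mstar γ M W b)
    (hd : Tendsto d atTop atTop) :
    ∀ᶠ n in atTop, IsSeparated (1 / √(k n)) ((M n)ᵀ * W n) (b n) := by
  obtain ⟨c, hc, C, hC, hmag⟩ := hnet.magnitude
  -- the constant makes `b_h ≤ (c / 2C) ‖U_h‖ / √(k ‖U_h‖₀) ≤ c γ / (2 √k)`
  filter_upwards [hnet.eventually_sparsity_pos hd, hmag, eventually_le_log hd 1,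
    hnet.intercept_lower 1 one_pos, hnet.intercept_upper (c / (2 * C)) (by positivity)]
    with n hk hmag hlog hlow hup
  have hsk := Real.sqrt_pos.mpr hk
  refine ⟨fun h => ?_, fun i h hi => ?_, hnet.same_sign n⟩
  · obtain ⟨i, hi⟩ := hnet.node_ne_zero n h
    have hm : (0 : ℝ) < colNorm0 ((M n)ᵀ * W n) h := by exact_mod_cast one_le_colNorm0 hi
    have h1 := hlow h
    rw [one_mul] at h1
    refine lt_of_lt_of_le ?_ h1
    have := colNorm_pos hi
    positivity
  · have hm : (0 : ℝ) < colNorm0 ((M n)ᵀ * W n) h := by exact_mod_cast one_le_colNorm0 hi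
    have hsm := Real.sqrt_pos.mpr hm
    have hB : 0 ≤ C * γ n := (abs_nonneg _).trans (hmag i h hi).2
    have hcol := colNorm_le_sqrt_mul hB fun j hj => (hmag j h hj).2
    have h1 := hup h
    rw [Real.sqrt_mul hk.le] at h1
    calc 2 * b n h ≤ 2 * (c / (2 * C) * (√(colNorm0 ((M n)ᵀ * W n) h) * (C * γ n)
          / (√(k n) * √(colNorm0 ((M n)ᵀ * W n) h)))) := by
            refine mul_le_mul_of_nonneg_left (h1.trans ?_) zero_le_two
            gcongr
      _ = c * γ n * (1 / √(k n)) := by field_simp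
      _ ≤ |((M n)ᵀ * W n) i h| * (1 / √(k n)) := by
            gcongr
            exact (hmag i h hi).1

/-- A perturbation of size `O(1 / (log d √(m* k)))` moves the input of each node by at most a
quarter of its threshold. -/
theorem eventually_colNorm_mul_le (hnet : NetworkClass d H k mstar γ M W b)
    (hd : Tendsto d atTop atTop) {A : ℝ} (hA : 0 < A) :
    ∀ᶠ n in atTop, ∀ h, colNorm ((M n)ᵀ * W n) h
      * (A * (1 / (Real.log (d n) * √(mstar n * k n)))) ≤ b n h / 4 := by
  filter_upwards [hnet.eventually_sparsity_pos hd, eventually_le_log hd 1,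
    hnet.intercept_lower (1 / (4 * A)) (by positivity)] with n hk hlog hlow h
  obtain ⟨i, hi⟩ := hnet.node_ne_zero n h
  have hm : (0 : ℝ) < colNorm0 ((M n)ᵀ * W n) h := by exact_mod_cast one_le_colNorm0 hi
  have hN := colNorm_pos hi
  have hsqrt : √(k n * colNorm0 ((M n)ᵀ * W n) h) ≤ √(mstar n * k n) := by
    refine Real.sqrt_le_sqrt ?_
    rw [mul_comm]
    exact mul_le_mul_of_nonneg_right (hnet.feature_count n h) hk.le
  have h0 : 0 < √(k n * colNorm0 ((M n)ᵀ * W n) h) := by positivity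
  calc colNorm ((M n)ᵀ * W n) h * (A * (1 / (Real.log (d n) * √(mstar n * k n))))
      ≤ colNorm ((M n)ᵀ * W n) h
          * (A * (1 / (Real.log (d n) * √(k n * colNorm0 ((M n)ᵀ * W n) h)))) := by gcongr
    _ = A * (colNorm ((M n)ᵀ * W n) h / √(k n * colNorm0 ((M n)ᵀ * W n) h)
          / Real.log (d n)) := by field_simp
    _ ≤ A * (1 / (4 * A) * b n h) := mul_le_mul_of_nonneg_left (hlow h) hA.le
    _ = b n h / 4 := by field_simp

end NetworkClass

/-! ### Typical realizations have high probability -/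

/-- The tail `exp (-q / (8 ζ² ℓ²))` beats a number `N ≤ q²` of events as soon as `q` dominates
`ℓ⁶`. -/
theorem mul_two_mul_exp_neg_le {ζ ℓ q c N : ℝ} (hζ : 0 < ζ) (hℓ : 0 < ℓ) (hq : 0 < q) (hc : 0 < c)
    (hN : N ≤ q ^ 2) (hqℓ : 6144 * ζ ^ 6 / c * ℓ ^ 6 ≤ q) :
    N * (2 * Real.exp (-(q / (8 * ζ ^ 2 * ℓ ^ 2)))) ≤ c := by
  set y := q / (8 * ζ ^ 2 * ℓ ^ 2) with hy
  have hy0 : 0 < y := by positivity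
  -- the cubic term of the exponential series beats the factor `q²`
  have hexp : Real.exp (-y) ≤ 6 / y ^ 3 := by
    have h1 := Real.pow_div_factorial_le_exp y hy0.le 3
    rw [Real.exp_neg, inv_le_comm₀ (Real.exp_pos _) (by positivity), inv_div]
    simpa [Nat.factorial] using h1
  calc N * (2 * Real.exp (-y)) ≤ q ^ 2 * (2 * (6 / y ^ 3)) := by gcongr
    _ = 6144 * ζ ^ 6 / c * ℓ ^ 6 * (c / q) := by rw [hy]; field_simp; norm_num
    _ ≤ q * (c / q) := by gcongr
    _ = c := by field_simp

section Model

variable {Ω : ℕ → Type*} [∀ n, MeasurableSpace (Ω n)] {P : (n : ℕ) → Measure (Ω n)}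
  {d H : ℕ → ℕ} {k mstar γ : ℕ → ℝ} {ζ : ℝ} {M : (n : ℕ) → Matrix (Fin (d n)) (Fin (d n)) ℝ}
  {X ξ : (n : ℕ) → Ω n → EuclideanSpace ℝ (Fin (d n))}
  {W : (n : ℕ) → Matrix (Fin (d n)) (Fin (H n)) ℝ} {b : (n : ℕ) → Fin (H n) → ℝ}

theorem SparseCodingModel.ae_amplitude (hmodel : SparseCodingModel P d k ζ M X ξ) (n : ℕ) :
    ∀ᵐ ω ∂(P n), ∀ i, X n ω i ≠ 0 → 1 / √(k n) ≤ |X n ω i| := by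
  rw [ae_all_iff]
  intro i
  filter_upwards [hmodel.support_coord n i] with ω hω hne
  exact (hω.resolve_left hne).1

variable [∀ n, IsProbabilityMeasure (P n)]

/-- The noise is harmless at all nodes simultaneously: the width and the sparsity leave room
for `H ≤ q²` Gaussian tails of order `exp (-c q / log² d)` with `q = d / (k ‖U_h‖₀) ≥ √d`. -/
theorem withHighProb_noise (hmodel : SparseCodingModel P d k ζ M X ξ)
    (hnet : NetworkClass d H k mstar γ M W b)
    (hwidth : UnifMuchLess (ι := fun n => Fin (H n))
      (fun n h => (H n : ℝ) * (k n * colNorm0 ((M n)ᵀ * W n) h) ^ 2)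
      (fun n _ => (d n : ℝ) ^ 2)) :
    WithHighProb P fun n ω => ∀ h, |((W n)ᵀ *ᵥ (ξ n ω).ofLp) h| ≤ b n h / 2 := by
  refine withHighProb_forall_of_measureReal_le fun c hc => ?_
  have hζ := hmodel.noise_scale_pos
  have hd := hmodel.dim_tendsto
  filter_upwards [hnet.eventually_sparsity_pos hd, eventually_le_log hd 1,
    hd.eventually_ge_atTop 1, hnet.eventually_dim_le_width, hwidth 1 one_pos,
    hnet.intercept_lower 1 one_pos,
    eventually_mul_log_pow_le hd 12 ((6144 * ζ ^ 6 / c) ^ 2)] with n hk hlog hd1 hdH hH hlow hpow h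
  obtain ⟨i, hi⟩ := hnet.node_ne_zero n h
  have hm : (0 : ℝ) < colNorm0 ((M n)ᵀ * W n) h := by exact_mod_cast one_le_colNorm0 hi
  have hN := colNorm_pos hi
  have hd0 : (0 : ℝ) < d n := by exact_mod_cast hd1
  have hH := hH h
  have hlow := hlow h
  rw [one_mul] at hlow hH
  have hcol := colNorm_transpose_mul (hmodel.orthogonal n) (W n) h
  set m : ℝ := (colNorm0 ((M n)ᵀ * W n) h : ℝ)
  set N := colNorm ((M n)ᵀ * W n) h 
  set ℓ := Real.log (d n)
  have hℓ0 : 0 < ℓ := by linarith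
  set q : ℝ := d n / (k n * m) with hq
  have hq0 : 0 < q := by positivity
  have hHq : (H n : ℝ) ≤ q ^ 2 := by
    rw [hq, div_pow, le_div_iff₀ (by positivity)]
    exact hH
  have hqℓ : 6144 * ζ ^ 6 / c * ℓ ^ 6 ≤ q := by
    refine le_of_sq_le_sq ?_ hq0.le
    calc (6144 * ζ ^ 6 / c * ℓ ^ 6) ^ 2 = (6144 * ζ ^ 6 / c) ^ 2 * ℓ ^ 12 := by ring
      -- `d ≤ H ≤ q²`, so that `q` is at least of order `√d`
      _ ≤ q ^ 2 := hpow.trans (hdH.trans hHq)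
  refine le_trans (mul_le_mul_of_nonneg_left ?_ (Nat.cast_nonneg _))
    (mul_two_mul_exp_neg_le hζ hℓ0 hq0 hc hHq hqℓ)
  have hb : 0 ≤ b n h / 2 := by
    have : 0 ≤ N / √(k n * m) / ℓ := by positivity
    linarith
  have htail := measureReal_lt_abs_sum_gaussian_le (μ := P n) (ξ := fun i ω => ξ n ω i)
    (fun i => by have := hmodel.measurable_noise n; fun_prop) (hmodel.noise_indep_coord n)
    (hmodel.noise_law n) (fun j => W n j h) hb
  have hset : {ω | ¬ |((W n)ᵀ *ᵥ (ξ n ω).ofLp) h| ≤ b n h / 2}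
      = {ω | b n h / 2 < |∑ i, W n i h * ξ n ω i|} := by
    ext ω; simp [Matrix.mulVec, dotProduct]
  rw [hset]
  refine htail.trans ?_
  rw [← sq_colNorm, ← hcol, Real.coe_toNNReal _ (by positivity), neg_div]
  refine mul_le_mul_of_nonneg_left (Real.exp_le_exp.mpr (neg_le_neg ?_)) zero_le_two
  calc q / (8 * ζ ^ 2 * ℓ ^ 2) = (N / √(k n * m) / ℓ / 2) ^ 2 / (2 * (N ^ 2 * (ζ ^ 2 / d n))) := by
        rw [hq, div_pow, div_pow, div_pow, Real.sq_sqrt (by positivity)]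
        field_simp
        norm_num
    _ ≤ (b n h / 2) ^ 2 / (2 * (N ^ 2 * (ζ ^ 2 / d n))) := by gcongr

theorem withHighProb_overlap (hmodel : SparseCodingModel P d k ζ M X ξ)
    {U : (n : ℕ) → Matrix (Fin (d n)) (Fin (H n)) ℝ}
    (hwidth : UnifMuchLess (ι := fun n => Fin (H n))
      (fun n h => (H n : ℝ) * (k n * colNorm0 (U n) h) ^ 2) (fun n _ => (d n : ℝ) ^ 2)) :
    WithHighProb P fun n ω => ∀ h i j, U n i h ≠ 0 → U n j h ≠ 0 → X n ω i ≠ 0 → X n ω j ≠ 0 →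
      i = j := by
  refine withHighProb_forall_of_measureReal_le fun c hc => ?_
  obtain ⟨_, -, C, hC, hprob⟩ := hmodel.prob_active
  filter_upwards [hprob, hwidth (c / C ^ 2) (by positivity),
    hmodel.dim_tendsto.eventually_ge_atTop 1] with n hp hH hd1 h
  have hd0 : (0 : ℝ) < d n := by exact_mod_cast hd1
  have hpair := measureReal_exists_pair_ne_zero_le (hmodel.indep_coord n) (fun i => (hp i).2)
    {i | U n i h ≠ 0}
  have hset : {ω | ¬ ∀ i j, U n i h ≠ 0 → U n j h ≠ 0 → X n ω i ≠ 0 → X n ω j ≠ 0 → i = j}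
      = {ω | ∃ i j, i ∈ {i | U n i h ≠ 0} ∧ j ∈ {i | U n i h ≠ 0} ∧ X n ω i ≠ 0 ∧ X n ω j ≠ 0
          ∧ i ≠ j} := by
    ext ω
    simp only [Set.mem_ofPred_eq]
    push Not
    rfl
  rw [hset]
  calc (H n : ℝ) * _ ≤ H n * (colNorm0 (U n) h * (C * (k n / d n))) ^ 2 := by
        gcongr
        exact hpair
    _ = C ^ 2 / d n ^ 2 * (H n * (k n * colNorm0 (U n) h) ^ 2) := by field_simp
    _ ≤ C ^ 2 / d n ^ 2 * (c / C ^ 2 * d n ^ 2) := by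
        exact mul_le_mul_of_nonneg_left (hH h) (by positivity)
    _ = c := by field_simp

theorem withHighProb_isTypical (hmodel : SparseCodingModel P d k ζ M X ξ)
    (hnet : NetworkClass d H k mstar γ M W b)
    (hwidth : UnifMuchLess (ι := fun n => Fin (H n))
      (fun n h => (H n : ℝ) * (k n * colNorm0 ((M n)ᵀ * W n) h) ^ 2)
      (fun n _ => (d n : ℝ) ^ 2)) :
    WithHighProb P fun n ω =>
      IsTypical (1 / √(k n)) ((M n)ᵀ * W n) (W n) (b n) (X n ω) (ξ n ω) :=
  (((withHighProb_overlap hmodel hwidth).and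
    (withHighProb_of_forall_ae hmodel.ae_amplitude)).and
      (withHighProb_noise hmodel hnet hwidth)).mono
    (Eventually.of_forall fun _ _ h => ⟨h.1.1, h.1.2, h.2⟩)

/-- For large `n`, each feature is the only active one, in a typical realization, with positive
probability: the features and the noise are independent. -/
theorem eventually_frequently_isTypical (hmodel : SparseCodingModel P d k ζ M X ξ)
    (hnet : NetworkClass d H k mstar γ M W b)
    (hwidth : UnifMuchLess (ι := fun n => Fin (H n))
      (fun n h => (H n : ℝ) * (k n * colNorm0 ((M n)ᵀ * W n) h) ^ 2)
      (fun n _ => (d n : ℝ) ^ 2)) :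
    ∀ᶠ n in atTop, ∀ i, ∃ᵐ ω ∂(P n), X n ω i ≠ 0 ∧
      IsTypical (1 / √(k n)) ((M n)ᵀ * W n) (W n) (b n) (X n ω) (ξ n ω) := by
  obtain ⟨c, hc, C, hC, hprob⟩ := hmodel.prob_active
  -- probability less than 1 for the complement is all that is needed of the noise event
  have hnoise := (withHighProb_noise hmodel hnet hwidth).eventually_lt_const
    (u := 1) (by simp)
  filter_upwards [hprob, hnoise, hnet.eventually_sparsity_pos hmodel.dim_tendsto,
    hmodel.dim_tendsto.eventually_ge_atTop 1,
    hmodel.sparsity.bound (c := (2 * C)⁻¹) (by positivity)] with n hp hno hk hd1 hsparse i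
  have hd0 : (0 : ℝ) < d n := by exact_mod_cast hd1
  rw [Real.norm_of_nonneg hk.le, Real.norm_natCast, inv_mul_eq_div, le_div_iff₀ (by positivity)]
    at hsparse
  have hsingle := measure_support_eq_singleton_pos (hmodel.measurable_X n) (hmodel.indep_coord n)
    (fun j => lt_of_lt_of_le (by positivity) (hp j).1)
    (fun j => lt_of_le_of_lt (hp j).2 (by rw [mul_div_assoc', div_lt_one hd0]; linarith)) i
  have hmeasX : MeasurableSet {x : EuclideanSpace ℝ (Fin (d n)) | ∀ j, x j ≠ 0 ↔ j = i} := by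
    simp only [Set.ofPred_forall]
    refine MeasurableSet.iInter fun j => ?_
    have hj : MeasurableSet {x : EuclideanSpace ℝ (Fin (d n)) | x j ≠ 0} := by
      have : Measurable fun x : EuclideanSpace ℝ (Fin (d n)) => x j := by fun_prop
      exact (this (measurableSet_singleton 0)).compl
    by_cases hji : j = i
    · simpa only [hji, iff_true] using hji ▸ hj
    · simp only [hji, iff_false]
      exact hj.compl
  have hmeasN : MeasurableSet {v : EuclideanSpace ℝ (Fin (d n)) |
      ∀ h, |((W n)ᵀ *ᵥ v.ofLp) h| ≤ b n h / 2} := by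
    simp only [Set.ofPred_forall]
    refine MeasurableSet.iInter fun h => measurableSet_le ?_ measurable_const
    simp only [Matrix.mulVec, dotProduct]
    fun_prop
  have hnoise_pos : 0 < P n {ω | ∀ h, |((W n)ᵀ *ᵥ (ξ n ω).ofLp) h| ≤ b n h / 2} := by
    rw [pos_iff_ne_zero]
    intro h0
    have h1 := prob_compl_eq_one_sub (μ := P n) (hmodel.measurable_noise n hmeasN)
    rw [show (ξ n ⁻¹' _) = {ω | ∀ h, |((W n)ᵀ *ᵥ (ξ n ω).ofLp) h| ≤ b n h / 2} from rfl, h0,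
      tsub_zero] at h1
    exact absurd hno (by rw [← h1]; exact lt_irrefl _)
  have hjoint : 0 < P n ({ω | ∀ j, X n ω j ≠ 0 ↔ j = i} ∩
      {ω | ∀ h, |((W n)ᵀ *ᵥ (ξ n ω).ofLp) h| ≤ b n h / 2}) := by
    have := (hmodel.noise_indep n).measure_inter_preimage_eq_mul _ _ hmeasX hmeasN
    exact lt_of_lt_of_eq (ENNReal.mul_pos hsingle.ne' hnoise_pos.ne') this.symm
  have hfreq : ∃ᵐ ω ∂(P n), ω ∈ {ω | ∀ j, X n ω j ≠ 0 ↔ j = i} ∩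
      {ω | ∀ h, |((W n)ᵀ *ᵥ (ξ n ω).ofLp) h| ≤ b n h / 2} :=
    frequently_ae_mem_iff.mpr hjoint.ne'
  refine (hfreq.and_eventually (hmodel.ae_amplitude n)).mono ?_
  rintro ω ⟨⟨hX, hN⟩, hamp⟩
  exact ⟨(hX i).mpr rfl, fun h j j' _ _ hj hj' => ((hX j).mp hj).trans ((hX j').mp hj').symm,
    hamp, hN⟩

/-- The attack changes the output of the network by `o(1)`: up to an event of vanishing probability
there are at most `k log d` active features, so that `‖gatedWeights‖² = O(m* k log d)`. -/
theorem withHighProb_mul_norm_gatedWeights_le (hmodel : SparseCodingModel P d k ζ M X ξ)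
    (hnet : NetworkClass d H k mstar γ M W b)
    (hwidth : UnifMuchLess (ι := fun n => Fin (H n))
      (fun n h => (H n : ℝ) * (k n * colNorm0 ((M n)ᵀ * W n) h) ^ 2)
      (fun n _ => (d n : ℝ) ^ 2))
    (hθ : (fun n => ‖((M n)ᵀ * W n) *ᵥ fun _ => (1 : ℝ)‖) =O[atTop] fun _ => (1 : ℝ))
    {ε : ℕ → ℝ} (hε0 : ∀ n, 0 ≤ ε n)
    (hε : ε =O[atTop] fun n => 1 / (Real.log (d n) * √(mstar n * k n))) {c : ℝ} (hc : 0 < c) :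
    WithHighProb P fun n ω =>
      ε n * ‖gatedWeights (fun _ => 1) ((M n)ᵀ * W n) (b n) (X n ω)‖ ≤ c := by
  have hd := hmodel.dim_tendsto
  obtain ⟨A, hA, hεA⟩ := hε.exists_pos
  obtain ⟨T, hT, hθT⟩ := hθ.exists_pos
  obtain ⟨c₁, hc₁, C₁, hC₁, hmag⟩ := hnet.magnitude
  have hcount : WithHighProb P fun n ω =>
      (Set.ncard {i | X n ω i ≠ 0} : ℝ) ≤ k n * Real.log (d n) := by
    refine withHighProb_of_forall_measureReal_le fun c hc => ?_
    obtain ⟨_, -, C, hC, hprob⟩ := hmodel.prob_active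
    filter_upwards [hprob, hnet.eventually_sparsity_pos hd, eventually_le_log hd (C / c),
      eventually_le_log hd 1, hd.eventually_ge_atTop 1] with n hp hk hlog hlog1 hd1
    have hd0 : (0 : ℝ) < d n := by exact_mod_cast hd1
    have := measureReal_lt_ncard_ne_zero_le (hmodel.measurable_X n) (fun i => (hp i).2)
      (t := k n * Real.log (d n)) (by positivity)
    simp only [not_le]
    refine this.trans ?_
    rw [show d n * (C * (k n / d n)) / (k n * Real.log (d n)) = C / Real.log (d n) by field_simp]
    rwa [div_le_comm₀ (by positivity) hc]
  refine ((withHighProb_isTypical hmodel hnet hwidth).and hcount).mono ?_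
  filter_upwards [hnet.eventually_isSeparated hd, hnet.eventually_sparsity_pos hd, hmag,
    hεA.bound, hθT.bound, eventually_le_log hd 1, hnet.eventually_featureBound_pos hd,
    eventually_le_log hd (A ^ 2 * T ^ 2 * (C₁ / c₁) / c ^ 2)]
    with n hs hk hmag hε hθ hlog hm hlogc ω ⟨ht, hcard⟩
  have hN := ht.sq_norm_gatedWeights_le hs (T := T) (K := C₁ / c₁) (m := mstar n)
    (fun i => by
      have h1 := norm_le_pi_norm (((M n)ᵀ * W n) *ᵥ fun _ => (1 : ℝ)) i
      simpa using h1.trans (by simpa using hθ)) hT.le (by positivity) hm.le (hnet.feature_count n)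
    (fun i j h hj => by
      have hγ : 0 ≤ C₁ * γ n := (abs_nonneg _).trans (hmag j h hj).2
      rcases eq_or_ne (((M n)ᵀ * W n) i h) 0 with h0 | h0
      · rw [h0, abs_zero]; positivity
      · calc _ ≤ C₁ * γ n := (hmag i h h0).2
          _ = C₁ / c₁ * (c₁ * γ n) := by field_simp
          _ ≤ _ := by gcongr; exact (hmag j h hj).1)
  have hε' : ε n ≤ A * (1 / (Real.log (d n) * √(mstar n * k n))) := by
    rw [Real.norm_of_nonneg (hε0 n), Real.norm_of_nonneg (by positivity)] at hε
    exact hε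
  refine le_of_sq_le_sq ?_ hc.le
  have hℓ0 : 0 < Real.log (d n) := by linarith
  calc (ε n * ‖gatedWeights (fun _ => 1) ((M n)ᵀ * W n) (b n) (X n ω)‖) ^ 2
      = ε n ^ 2 * ‖gatedWeights (fun _ => 1) ((M n)ᵀ * W n) (b n) (X n ω)‖ ^ 2 := by ring
    _ ≤ (A * (1 / (Real.log (d n) * √(mstar n * k n)))) ^ 2
        * (T * (mstar n * (C₁ / c₁) * (T * (k n * Real.log (d n))))) := by
        gcongr
        · exact hε0 n
        · exact hN.trans (by gcongr)
    _ = A ^ 2 * T ^ 2 * (C₁ / c₁) / Real.log (d n) := by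
        rw [mul_pow, div_pow, mul_pow, Real.sq_sqrt (by positivity)]
        field_simp
    _ ≤ c ^ 2 := by
        rw [div_le_iff₀ (by positivity)] at hlogc
        rwa [div_le_iff₀ hℓ0, mul_comm (c ^ 2)]

end Model

theorem lemma1
    {Ω : ℕ → Type*} [∀ n, MeasurableSpace (Ω n)]
    (P : (n : ℕ) → Measure (Ω n)) [∀ n, IsProbabilityMeasure (P n)]
    (d H : ℕ → ℕ) (k mstar γ ε : ℕ → ℝ) (ζ : ℝ)
    (M : (n : ℕ) → Matrix (Fin (d n)) (Fin (d n)) ℝ)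
    (X ξ Z : (n : ℕ) → Ω n → EuclideanSpace ℝ (Fin (d n)))
    (hmodel : SparseCodingModel P d k ζ M X ξ)
    (hZ : ∀ n ω, Z n ω = observed (M n) (X n ω) (ξ n ω))
    (W U : (n : ℕ) → Matrix (Fin (d n)) (Fin (H n)) ℝ)
    (b a : (n : ℕ) → Fin (H n) → ℝ)
    (hnet : NetworkClass d H k mstar γ M W b)
    (hU : ∀ n, U n = (M n)ᵀ * W n)
    (ha : ∀ n h, a n h = 1)
    -- the width is `o(d² / (k² m²))` with `m = sup_h ‖U_h‖₀`
    (hwidth : UnifMuchLess (ι := fun n => Fin (H n))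
      (fun n h => (H n : ℝ) * (k n * colNorm0 (U n) h) ^ 2) (fun n _ => (d n : ℝ) ^ 2))
    (θ : (n : ℕ) → EuclideanSpace ℝ (Fin (d n)))
    (hθ : ∀ n, θ n = WithLp.toLp 2 (U n *ᵥ a n))
    (hθ_sup : (fun n => ‖(θ n).ofLp‖) =Θ[atTop] (fun _ => (1 : ℝ)))
    (hε_nonneg : ∀ n, 0 ≤ ε n)
    (hε : ε =O[atTop] (fun n => 1 / (Real.log (d n) * √(mstar n * k n))))
    (l : ℝ → ℝ → ℝ) :
    -- first-order expansion of the loss increase; the remainder is controlled by the curvature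
    -- of the loss between the clean and the attacked output, simultaneously for all responses
    (WithHighProb P fun n ω => ∀ (y : ℝ) (L : ℝ≥0),
      (∀ s ∈ Set.uIcc (network (a n) (W n) (b n) (Z n ω))
          (network (a n) (W n) (b n)
            (Z n ω + fgmAttack l (ε n) (a n) (W n) (b n) (Z n ω) y)),
        DifferentiableAt ℝ (fun t => l t y) s) →
      LipschitzOnWith L (deriv (fun t => l t y))
        (Set.uIcc (network (a n) (W n) (b n) (Z n ω))
          (network (a n) (W n) (b n)
            (Z n ω + fgmAttack l (ε n) (a n) (W n) (b n) (Z n ω) y))) →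
      |lossIncrease l (ε n) (a n) (W n) (b n) (Z n ω) y
          - ε n * |deriv (fun t => l t y) (network (a n) (W n) (b n) (Z n ω))|
            * ‖gatedWeights (a n) (W n) (b n) (Z n ω)‖|
        ≤ L / 2 * (ε n * ‖gatedWeights (a n) (W n) (b n) (Z n ω)‖) ^ 2) ∧
    (∀ c > 0, WithHighProb P fun n ω =>
      ε n * ‖gatedWeights (a n) (W n) (b n) (Z n ω)‖ ≤ c) ∧
    -- two-sided bound, for the noiseless and for the noisy gates
    (WithHighProb P fun n ω =>
      ‖restrictActive (θ n) (X n ω)‖ ≤ ‖gatedWeights (a n) (U n) (b n) (X n ω)‖ ∧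
      ‖gatedWeights (a n) (U n) (b n) (X n ω)‖ ≤ ‖θ n‖) ∧
    (WithHighProb P fun n ω =>
      ‖restrictActive (θ n) (X n ω)‖ ≤ ‖gatedWeights (a n) (W n) (b n) (Z n ω)‖ ∧
      ‖gatedWeights (a n) (W n) (b n) (Z n ω)‖ ≤ ‖θ n‖) ∧
    -- lower equality, realization by realization: only if all activated nodes are pure
    (WithHighProb P fun n ω =>
      (‖restrictActive (θ n) (X n ω)‖ = ‖gatedWeights (a n) (U n) (b n) (X n ω)‖ ↔
        ∀ h, b n h ≤ |((U n)ᵀ *ᵥ (X n ω).ofLp) h| → colNorm0 (U n) h ≤ 1)) ∧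
    (WithHighProb P fun n ω =>
      (‖restrictActive (θ n) (X n ω)‖ = ‖gatedWeights (a n) (W n) (b n) (Z n ω)‖ ↔
        ∀ h, b n h ≤ |((W n)ᵀ *ᵥ (Z n ω).ofLp) h| → colNorm0 (U n) h ≤ 1)) ∧
    -- lower equality for (almost) all realizations: only if every hidden node is pure
    (∀ᶠ n in atTop,
      (∀ᵐ ω ∂(P n),
        ‖restrictActive (θ n) (X n ω)‖ = ‖gatedWeights (a n) (U n) (b n) (X n ω)‖) →
      ∀ h, colNorm0 (U n) h ≤ 1) ∧
    (∀ᶠ n in atTop,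
      (∀ᵐ ω ∂(P n),
        ‖restrictActive (θ n) (X n ω)‖ = ‖gatedWeights (a n) (W n) (b n) (Z n ω)‖) →
      ∀ h, colNorm0 (U n) h ≤ 1) ∧
    -- upper equality when all hidden nodes are activated
    (∀ n ω, (∀ h, b n h ≤ |((U n)ᵀ *ᵥ (X n ω).ofLp) h|) →
      ‖gatedWeights (a n) (U n) (b n) (X n ω)‖ = ‖θ n‖) ∧
    (∀ n ω, (∀ h, b n h ≤ |((W n)ᵀ *ᵥ (Z n ω).ofLp) h|) →
      ‖gatedWeights (a n) (W n) (b n) (Z n ω)‖ = ‖θ n‖) := by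
  obtain rfl : a = fun n _ => 1 := by ext n h; exact ha n h
  obtain rfl : U = fun n => (M n)ᵀ * W n := funext hU
  obtain rfl : Z = fun n ω => observed (M n) (X n ω) (ξ n ω) := by ext1 n; ext1 ω; exact hZ n ω
  obtain rfl : θ = fun n => WithLp.toLp 2 (((M n)ᵀ * W n) *ᵥ fun _ => 1) := funext hθ
  have hd := hmodel.dim_tendsto
  have hM := hmodel.orthogonal
  have htyp := withHighProb_isTypical hmodel hnet hwidth
  have hsep := hnet.eventually_isSeparated hd
  obtain ⟨A, hA, hεA⟩ := hε.exists_pos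
  refine ⟨?_, fun c hc => ?_, ?_, ?_, ?_, ?_, ?_, ?_, fun n ω hact => ?_, fun n ω hact => ?_⟩
  · refine htyp.mono ?_
    filter_upwards [hsep, hnet.eventually_colNorm_mul_le hd hA, hεA.bound,
      hnet.eventually_sparsity_pos hd, eventually_le_log hd 1,
      hnet.eventually_featureBound_pos hd] with n hs hcol hεn hk hlog hm ω ht y L hdiff hlip
    rw [Real.norm_of_nonneg (hε_nonneg n), Real.norm_of_nonneg (by positivity)] at hεn
    -- the gates are constant on the ball of radius `A / (log d √(m* k))`, positive even if `ε = 0`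
    refine abs_lossIncrease_sub_le (hε_nonneg n) hεn (by positivity) (fun u hu h => ?_) hdiff hlip
    refine ht.gate_eq_of_norm_sub_le hs (fun h => ?_) hu h
    rw [← colNorm_transpose_mul (hM n)]
    exact hcol h
  · refine (htyp.and (withHighProb_mul_norm_gatedWeights_le hmodel hnet hwidth ?_ hε_nonneg hε
      hc)).mono ?_
    · exact hθ_sup.isBigO
    · filter_upwards [hsep] with n hs ω ⟨ht, hle⟩
      rwa [ht.norm_gatedWeights_observed (hM n) hs]
  · refine htyp.mono ?_
    filter_upwards [hsep] with n hs ω ht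
    exact ⟨ht.norm_restrictActive_le hs, norm_gatedWeights_one_le hs.same_sign _⟩
  · refine htyp.mono ?_
    filter_upwards [hsep] with n hs ω ht
    rw [ht.norm_gatedWeights_observed (hM n) hs]
    exact ⟨ht.norm_restrictActive_le hs, norm_gatedWeights_one_le hs.same_sign _⟩
  · refine htyp.mono ?_
    filter_upwards [hsep] with n hs ω ht
    exact ht.norm_restrictActive_eq_iff hs
  · refine htyp.mono ?_
    filter_upwards [hsep] with n hs ω ht
    rw [ht.norm_gatedWeights_observed (hM n) hs, ht.norm_restrictActive_eq_iff hs]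
    simp only [ht.threshold_le_iff_isHit hs, ht.threshold_le_observed_iff_isHit hs]
  · filter_upwards [hsep, eventually_frequently_isTypical hmodel hnet hwidth] with n hs hfreq hae h
    obtain ⟨i, hi⟩ := hnet.node_ne_zero n h
    obtain ⟨ω, ⟨hx, ht⟩, heq⟩ := ((hfreq i).and_eventually hae).exists
    exact (ht.norm_restrictActive_eq_iff hs).mp heq h
      ((ht.threshold_le_iff_isHit hs h).mpr ⟨i, hi, hx⟩)
  · filter_upwards [hsep, eventually_frequently_isTypical hmodel hnet hwidth] with n hs hfreq hae h
    obtain ⟨i, hi⟩ := hnet.node_ne_zero n h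
    obtain ⟨ω, ⟨hx, ht⟩, heq⟩ := ((hfreq i).and_eventually hae).exists
    rw [ht.norm_gatedWeights_observed (hM n) hs] at heq
    exact (ht.norm_restrictActive_eq_iff hs).mp heq h
      ((ht.threshold_le_iff_isHit hs h).mpr ⟨i, hi, hx⟩)
  · rw [← WithLp.toLp_ofLp (p := 2) (gatedWeights _ _ _ _), gatedWeights_eq_mulVec]
    simp only [gate_of_le (hact _), mul_one]
  · exact norm_gatedWeights_of_forall_le (hM n) hact
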